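/- All logarithms are to base $2$. A capacitated graph $G=(V,E,c)$ is a finite undirected graph with edge capacities $c(e)\ge 1$; $T\subseteq V$ is its set of terminals. A demand $\mathcal D$ on $T$ assigns a real number $\mathcal D_{t,t'}\ge 0$ to every unordered pair of distinct terminals, not all zero. A flow assigns a number $f_P\ge 0$ to every path $P$ between two terminals; it routes $\mathcal D$ if for all distinct $t,t'\in T$ the values of $f$ on the $t$-$t'$ paths sum to $\mathcal D_{t,t'}$. The congestion of a flow is $\max_{e\in E}\frac1{c(e)}\sum_{P\ni e}f_P$, and $\mathrm{cong}_G(\mathcal D)$ is the minimum congestion of a flow that routes $\mathcal D$ in $G$ ($\infty$ if there is none). A partition $\mathcal F$ of $V$ is valid if distinct terminals lie in distinct clusters of $\mathcal F$. The contracted graph $H$ of $G$ with respect to $\mathcal F$ has the clusters as vertices; distinct clusters $A,B$ are adjacent if $G$ has an edge between them, and the capacity of $(A,B)$ is the total capacity of the edges of $G$ between $A$ and $B$. In $H$, each terminal is identified with the cluster that contains it. **Theorem.** Let $0<\varepsilon<1$, $\alpha=\frac{\log 5}{\log 5+1-\varepsilon}$ and $\beta=\frac{\log 5-0.5\varepsilon}{\log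 5+1-\varepsilon}$. There is a constant $c_0>0$ such that for every large enough integer $n$ there exist a connected $n$-vertex capacitated graph $G=(V,E,c)$ and a set $T\subseteq V$ of $\left\lfloor n/2^{(\log n)^{\alpha}}\right\rfloor$ terminals with the following property. For every valid partition $\mathcal F$ of $V$ of size $|\mathcal F|=O\!\left(n/2^{(\log n)^{\beta}}\right)$ there is a demand $\mathcal D$ on $T$ with $$\mathrm{cong}_G(\mathcal D)\ \ge\ c_0\,(\log n)^{1-\alpha}\qquad\text{and}\qquad \mathrm{cong}_H(\mathcal D)\le 3,$$ where $H$ is the contracted graph of $G$ with respect to $\mathcal F$. Here the $O(\cdot)$ means: for every constant $C$ there is $N(C)$ (depending only on $\varepsilon$ and $C$) such that the property holds for all $n\ge N(C)$ and all valid $\mathcal F$ with $|\mathcal F|\le C\,n/2^{(\log n)^{\beta}}$; neither the graphs $G$ and sets $T$ (one pair for each $n$) nor the constant $c_0$ depend on $C$. -/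

import Mathlib

open scoped NNReal ENNReal

noncomputable section

/-- A finite undirected graph `G = (V, E, c)` with edge capacities `c(e) ≥ 1`.
(Values of `cap` outside the edge set are never used.) -/
structure CapGraph (V : Type*) where
  graph : SimpleGraph V
  cap : Sym2 V → ℝ≥0
  one_le_cap : ∀ e ∈ graph.edgeSet, 1 ≤ cap e

/-- A demand on a set `ι` of terminals: a nonnegative number for every unordered pair of distinct
terminals (encoded as a symmetric function vanishing on the diagonal), not all of them zero. -/
structure Demand (ι : Type*) where
  val : ι → ι → ℝ≥0
  symm : ∀ t t', val t t' = val t' t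
  diag : ∀ t, val t t = 0
  ne_zero : ∃ t t', val t t' ≠ 0

namespace CapGraph

variable {V : Type*} [Fintype V] [DecidableEq V]

open Classical in
/-- The collection of (simple) `u`-`v` paths of `G`. Edges being undirected, a path is recorded as
its set of edges, so that the `u`-`v` paths and the `v`-`u` paths are the same objects. -/
def paths (G : CapGraph V) (u v : V) : Finset (Finset (Sym2 V)) :=
  Finset.univ.filter fun P => ∃ p : G.graph.Walk u v, p.IsPath ∧ p.edges.toFinset = P

variable {ι : Type*}

open Classical in
/-- The collection of all paths of `G` between terminals; the terminal `t : ι` is located at the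
vertex `τ t`. -/
def terminalPaths (G : CapGraph V) (τ : ι → V) : Finset (Finset (Sym2 V)) :=
  Finset.univ.filter fun P => ∃ t t', P ∈ G.paths (τ t) (τ t')

/-- The flow `f` (a nonnegative amount for each path) routes the demand `D`. -/
def Routes (G : CapGraph V) (τ : ι → V) (f : Finset (Sym2 V) → ℝ≥0) (D : Demand ι) : Prop :=
  ∀ t t', t ≠ t' → ∑ P ∈ G.paths (τ t) (τ t'), f P = D.val t t'

/-- The congestion of a flow: the maximum over the edges of `G` of the amount of flow sent through
the edge divided by its capacity (`0` if there are no edges). -/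
def flowCong (G : CapGraph V) (τ : ι → V) (f : Finset (Sym2 V) → ℝ≥0) : ℝ≥0∞ :=
  ⨆ e ∈ G.graph.edgeSet,
    (((∑ P ∈ (G.terminalPaths τ).filter (fun P => e ∈ P), f P) / G.cap e : ℝ≥0) : ℝ≥0∞)

/-- The congestion of a demand: the least congestion of a flow that routes it
(`∞` if no flow routes it). -/
def cong (G : CapGraph V) (τ : ι → V) (D : Demand ι) : ℝ≥0∞ :=
  ⨅ (f : Finset (Sym2 V) → ℝ≥0) (_ : G.Routes τ f D), G.flowCong τ f

end CapGraph

section Contraction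

variable {V : Type*} [Fintype V] [DecidableEq V]

/-- The cluster `F(u)` of the partition `F` that contains the vertex `u`. -/
def clusterOf (F : Finpartition (Finset.univ : Finset V)) (u : V) : F.parts :=
  ⟨F.part u, F.part_mem.2 (Finset.mem_univ u)⟩

/-- A partition is valid for the terminal set `T` if distinct terminals lie in distinct clusters. -/
def ValidPartition (T : Finset V) (F : Finpartition (Finset.univ : Finset V)) : Prop :=
  ∀ t ∈ T, ∀ t' ∈ T, clusterOf F t = clusterOf F t' → t = t'

open Classical in
/-- The contracted graph `H` of `G` with respect to the partition `F`: its vertices are the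
clusters, two distinct clusters are adjacent if some edge of `G` joins them, and the capacity of
`(A, B)` is the total capacity of all edges of `G` between `A` and `B`. -/
def CapGraph.contract (G : CapGraph V) (F : Finpartition (Finset.univ : Finset V)) :
    CapGraph F.parts where
  graph :=
    { Adj := fun A B => A ≠ B ∧ ∃ u v, clusterOf F u = A ∧ clusterOf F v = B ∧ G.graph.Adj u v
      symm := ⟨fun _ _ h => ⟨h.1.symm, by
        obtain ⟨_, u, v, hu, hv, h⟩ := h
        exact ⟨v, u, hv, hu, h.symm⟩⟩⟩
      loopless := ⟨fun _ h => h.1 rfl⟩ }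
  cap := fun e' => ∑ e ∈ G.graph.edgeFinset.filter (fun e => e.map (clusterOf F) = e'), G.cap e
  one_le_cap := by
    intro e' he'
    induction e' with
    | _ A B =>
      obtain ⟨_, u, v, rfl, rfl, h⟩ := he'
      have hmem : s(u, v) ∈ G.graph.edgeFinset.filter
          (fun e => e.map (clusterOf F) = s(clusterOf F u, clusterOf F v)) := by
        simp [h]
      exact (G.one_le_cap s(u, v) h).trans
        (Finset.single_le_sum (f := G.cap) (fun _ _ => zero_le) hmem)

end Contraction

end

/-! Weight each pair of terminals by its distance in `G`. A flow in `G` consumes capacity at least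
the weighted distance of its demand, so a demand whose weighted distance exceeds `2 * x` times the
total capacity (ordered pairs count twice) has congestion at least `x` in `G`. By LP duality
(`exists_demand_or_exists_length`), either such a demand has congestion at most 3 in `H`, or there
are edge lengths on `H` of small volume under which terminals are at least as far apart as in `G`.
The second case has to be refuted when there are few clusters.

The graph has large girth and consists of a Hamiltonian path and `Δ` disjoint, nearly perfect
matchings, with `Δ` of order `log n`. Terminals form a net: almost every vertex `u` has a path `p u`
of at most `r` edges to a terminal. An edge gets capacity `1` plus `Δ / r` for each chosen path
through it. The total capacity stays `O(n * Δ)`, while a volume bound now controls both the average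
edge length, `O(x)`, and the average length of the chosen paths, `O(x * r)`. Hence for most
vertices, the good ones, distances in `H` dominate those in `G` up to an additive `b = O(x * r)`.

`LocallyTree.not_few_clusters` refutes this by a random walk. If clusters are large on average
compared with balls of radius `R`, some permutation `σ` preserves each cluster and moves most
vertices by at least `R`; this costs nothing in `H`. Alternate `σ` with a uniformly random matching
for `4 * r` steps. Every position is uniformly distributed, so the first moment method yields a
trajectory of `H`-length at most `b` that starts at a good vertex, jumps by at least `R` more than
half of the time, and never turns back. By large girth the jumps add up in `G`, and for `R = O(x)`
their sum exceeds what the additive bound allows.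

Large girth requires `x * (log n) ^ α = O(log n)`, which sets `x` of order `(log n) ^ (1 - α)`.
Balls of radius `R` then have size `2 ^ O((log n) ^ (1 - α) * log log n)`, which is `o(2 ^ (log n) ^
β)` because `1 - α < β`. -/

namespace CapGraph

/-! ### LP duality between routable demands and edge lengths -/

open Classical in
/-- Either some demand of congestion at most `3` has weighted value more than `V`, or there is
a system of edge lengths of total volume at most `V / 3` that dominates the weights `δ`. -/
theorem exists_demand_or_exists_length {W ι : Type*} [Fintype W] [DecidableEq W] [Fintype ι]
    (H : CapGraph W) (τ : ι → W) (δ : ι → ι → ℝ) {V : ℝ} (hV : 0 ≤ V)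
    (hδ : ∀ t t', 0 ≤ δ t t') (hδ0 : ∀ t, δ t t = 0) :
    (∃ D : Demand ι, H.cong τ D ≤ 3 ∧ V < ∑ t, ∑ t', (D.val t t' : ℝ) * δ t t') ∨
    ∃ ℓ : Sym2 W → ℝ, (∀ e, 0 ≤ ℓ e) ∧ 3 * ∑ e ∈ H.graph.edgeFinset, (H.cap e : ℝ) * ℓ e ≤ V ∧
      ∀ t t', t ≠ t' → ∀ P ∈ H.paths (τ t) (τ t'), δ t t' ≤ ∑ e ∈ P, ℓ e := by
  -- The value `1` off the edge set only keeps the bounds positive; no path uses such pairs.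
  set c : Sym2 W → ℝ := fun e => if e ∈ H.graph.edgeSet then (H.cap e : ℝ) else 1 with hc
  have hcpos : ∀ e, 0 < c e := by
    intro e
    by_cases he : e ∈ H.graph.edgeSet
    · have h1 := H.one_le_cap e he
      have h2 : (1 : ℝ) ≤ H.cap e := by exact_mod_cast h1
      simp only [hc, he, if_true]
      linarith
    · simp [hc, he]
  let load : (Finset (Sym2 W) → ℝ) →ₗ[ℝ] (Sym2 W → ℝ) :=
    { toFun := fun f e => ∑ P ∈ (H.terminalPaths τ).filter (fun P => e ∈ P), f P
      map_add' := by intro f g; ext e; simp [Finset.sum_add_distrib]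
      map_smul' := by intro a f; ext e; simp [Finset.mul_sum] }
  let val : (Finset (Sym2 W) → ℝ) →ₗ[ℝ] ℝ :=
    { toFun := fun f => ∑ t, ∑ t', (∑ P ∈ H.paths (τ t) (τ t'), f P) * δ t t'
      map_add' := by intro f g; simp [Finset.sum_add_distrib, add_mul]
      map_smul' := by intro a f; simp [Finset.mul_sum, Finset.sum_mul, mul_assoc] }
  let K : Set ((Sym2 W → ℝ) × ℝ) := (load.prod val) '' {f | ∀ P, 0 ≤ f P}
  -- Both inequalities are strict so that `U` is open. A common point of `U` and `K` is a flow
  -- giving the demand; otherwise a separating hyperplane gives the lengths.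
  let U : Set ((Sym2 W → ℝ) × ℝ) := {x | (∀ e, x.1 e < 3 * c e) ∧ V < x.2}
  have hpos : Convex ℝ {f : Finset (Sym2 W) → ℝ | ∀ P, 0 ≤ f P} := by
    intro f hf g hg a b ha hb _ P
    exact add_nonneg (mul_nonneg ha (hf P)) (mul_nonneg hb (hg P))
  have hK : Convex ℝ K := hpos.linear_image _
  have hUo : IsOpen U := by
    have h1 : IsOpen (⋂ e, {x : (Sym2 W → ℝ) × ℝ | x.1 e < 3 * c e}) :=
      isOpen_iInter_of_finite fun e => isOpen_lt (by fun_prop) continuous_const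
    have h2 : IsOpen {x : (Sym2 W → ℝ) × ℝ | V < x.2} := isOpen_lt continuous_const (by fun_prop)
    have : U = (⋂ e, {x : (Sym2 W → ℝ) × ℝ | x.1 e < 3 * c e}) ∩ {x | V < x.2} := by
      ext x; simp [U]
    rw [this]
    exact h1.inter h2
  have hU : Convex ℝ U := by
    have h1 : Convex ℝ (⋂ e, {x : (Sym2 W → ℝ) × ℝ | x.1 e < 3 * c e}) :=
      convex_iInter fun e =>
        convex_halfSpace_lt (f := fun x : (Sym2 W → ℝ) × ℝ => x.1 e)
          ⟨fun _ _ => rfl, fun _ _ => rfl⟩ _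
    have h2 : Convex ℝ {x : (Sym2 W → ℝ) × ℝ | V < x.2} :=
      convex_halfSpace_gt (f := fun x : (Sym2 W → ℝ) × ℝ => x.2) ⟨fun _ _ => rfl, fun _ _ => rfl⟩ _
    have : U = (⋂ e, {x : (Sym2 W → ℝ) × ℝ | x.1 e < 3 * c e}) ∩ {x | V < x.2} := by
      ext x; simp [U]
    rw [this]
    exact h1.inter h2
  by_cases hdisj : Disjoint U K
  · right
    obtain ⟨φ, s, hφU, hφK⟩ := geometric_hahn_banach_open hU hUo hK hdisj
    have hs : s ≤ 0 := by
      have := hφK 0 ⟨0, fun _ => le_rfl, by simp⟩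
      simpa using this
    -- `K` is a cone, so a functional bounded below on it cannot be negative there.
    have hKnn : ∀ x ∈ K, 0 ≤ φ x := by
      rintro x ⟨f, hf, rfl⟩
      by_contra! hneg
      set y := φ ((load.prod val) f)
      have hy : 0 < (s - 1) / y := div_pos_of_neg_of_neg (by linarith) hneg
      have := hφK (((s - 1) / y) • (load.prod val) f)
        ⟨((s - 1) / y) • f, fun P => mul_nonneg hy.le (hf P), by simp⟩
      rw [map_smul, smul_eq_mul, div_mul_cancel₀ _ hneg.ne] at this
      linarith
    set y : Sym2 W → ℝ := fun e => φ (Pi.single e 1, 0) with hy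
    set z : ℝ := - φ (0, 1) with hz
    have hφ : ∀ (x : Sym2 W → ℝ) (v : ℝ), φ (x, v) = ∑ e, x e * y e - v * z := by
      intro x v
      have h1 : ((x, v) : (Sym2 W → ℝ) × ℝ)
          = ∑ e, x e • ((Pi.single e (1:ℝ), 0) : (Sym2 W → ℝ) × ℝ) + v • (0, 1) := by
        refine Prod.ext ?_ ?_
        · simp only [Prod.fst_add, Prod.fst_sum, Prod.smul_fst, smul_zero, add_zero]
          funext e'
          simp [Finset.sum_apply, Pi.single_apply]
        · simp [Prod.snd_sum]
      rw [h1, map_add, map_sum]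
      simp only [map_smul, smul_eq_mul, hy, hz]
      ring
    have hUneg : ∀ (x : Sym2 W → ℝ) (v : ℝ), (∀ e, x e < 3 * c e) → V < v → ∑ e, x e * y e < v * z := by
      intro x v hx hv
      have := hφU (x, v) ⟨hx, hv⟩
      rw [hφ] at this
      linarith
    have hy0 : ∀ e, 0 ≤ y e := by
      intro e
      by_contra! hneg
      obtain ⟨A, hA⟩ : ∃ A : ℝ, A = |(V + 1) * z| + 1 := ⟨_, rfl⟩
      have hA0 : 0 < A := by rw [hA]; positivity
      -- Loads in `U` may be arbitrarily negative; this one contributes exactly `A` to the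
      -- functional.
      have := hUneg (Pi.single e (A / y e)) (V + 1) (by
        intro e'
        by_cases h : e' = e
        · subst h
          simp only [Pi.single_eq_same]
          have := div_neg_of_pos_of_neg hA0 hneg
          have := hcpos e'
          linarith
        · simp only [Pi.single_apply, h, if_false]
          have := hcpos e'
          linarith) (by linarith)
      simp only [Pi.single_apply, ite_mul, zero_mul, Finset.sum_ite_eq', Finset.mem_univ,
        if_true, div_mul_cancel₀ _ hneg.ne] at this
      have := le_abs_self ((V + 1) * z)
      linarith
    have hz0 : 0 < z := by
      have h1 := hUneg c (V + 1) (fun e => by have := hcpos e; linarith) (by linarith)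
      have h2 : 0 ≤ ∑ e, c e * y e :=
        Finset.sum_nonneg fun e _ => mul_nonneg (hcpos e).le (hy0 e)
      nlinarith
    refine ⟨fun e => y e / z, fun e => div_nonneg (hy0 e) hz0.le, ?_, ?_⟩
    -- Let points of `U` approach its corner `(3 * c, V)`.
    · have key : 3 * ∑ e, c e * y e ≤ V * z := by
        refine le_of_forall_pos_lt_add fun η hη => ?_
        obtain ⟨S, hS⟩ : ∃ S, S = ∑ e, c e * y e := ⟨_, rfl⟩
        have hS0 : 0 ≤ S := by
          rw [hS]; exact Finset.sum_nonneg fun e _ => mul_nonneg (hcpos e).le (hy0 e)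
        have hξ : ∃ ξ : ℝ, 0 < ξ ∧ ξ < 1 ∧ ξ * (3 * S) ≤ η / 2 := by
          refine ⟨min (1/2) (η / 2 / (3 * S + 1)), by positivity, ?_, ?_⟩
          · exact (min_le_left _ _).trans_lt (by norm_num)
          · calc _ ≤ (η / 2 / (3 * S + 1)) * (3 * S + 1) := by
                  gcongr
                  · exact min_le_right _ _
                  · linarith
              _ = η / 2 := div_mul_cancel₀ _ (by positivity)
        obtain ⟨ξ, h0, h1, h2⟩ := hξ
        have := hUneg (fun e => (3 - 3 * ξ) * c e) (V + η / 2 / z)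
          (fun e => by have := hcpos e; nlinarith) (by
            have : 0 < η / 2 / z := by positivity
            linarith)
        simp only [mul_assoc] at this
        rw [← Finset.mul_sum, ← hS, add_mul, div_mul_cancel₀ _ hz0.ne'] at this
        rw [← hS]
        nlinarith
      have h2 : ∑ e ∈ H.graph.edgeFinset, (H.cap e : ℝ) * y e ≤ ∑ e, c e * y e := by
        calc _ = ∑ e ∈ H.graph.edgeFinset, c e * y e := by
              refine Finset.sum_congr rfl fun e he => ?_
              rw [SimpleGraph.mem_edgeFinset] at he
              simp [hc, he]
          _ ≤ _ := Finset.sum_le_sum_of_subset_of_nonneg (Finset.subset_univ _)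
              fun e _ _ => mul_nonneg (hcpos e).le (hy0 e)
      have h3 : ∑ e ∈ H.graph.edgeFinset, (H.cap e : ℝ) * (y e / z)
          = (∑ e ∈ H.graph.edgeFinset, (H.cap e : ℝ) * y e) / z := by
        rw [Finset.sum_div]
        exact Finset.sum_congr rfl fun _ _ => by ring
      rw [h3, ← mul_div_assoc, div_le_iff₀ hz0]
      linarith
    · intro t t' htt' P hP
      have hPt : P ∈ H.terminalPaths τ := by
        simp only [terminalPaths, Finset.mem_filter, Finset.mem_univ, true_and]
        exact ⟨t, t', hP⟩
      -- Test the functional on one unit of flow along `P`.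
      have h1 := hKnn _ ⟨Pi.single P 1, fun Q => by
        by_cases h : Q = P
        · subst h; simp
        · simp [h], rfl⟩
      have h2 : load (Pi.single P 1) = fun e => if e ∈ P then 1 else 0 := by
        funext e
        change ∑ Q ∈ (H.terminalPaths τ).filter (fun Q => e ∈ Q),
          (Pi.single P 1 : Finset (Sym2 W) → ℝ) Q = _
        simp [Pi.single_apply, Finset.sum_ite_eq', hPt]
      -- Only an inequality, since `P` also counts for other pairs, such as the reversed one.
      have h3 : δ t t' ≤ val (Pi.single P 1) := by
        change _ ≤ ∑ t, ∑ t', (∑ Q ∈ H.paths (τ t) (τ t'),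
          (Pi.single P 1 : Finset (Sym2 W) → ℝ) Q) * δ t t'
        have hnn : ∀ a b, 0 ≤ (∑ Q ∈ H.paths (τ a) (τ b),
            (Pi.single P 1 : Finset (Sym2 W) → ℝ) Q) * δ a b := by
          intro a b
          refine mul_nonneg (Finset.sum_nonneg fun Q _ => ?_) (hδ _ _)
          by_cases h : Q = P
          · subst h; simp
          · simp [h]
        refine le_trans ?_ (Finset.single_le_sum (fun a _ => Finset.sum_nonneg fun b _ => hnn a b)
          (Finset.mem_univ t))
        refine le_trans ?_ (Finset.single_le_sum (fun b _ => hnn t b) (Finset.mem_univ t'))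
        simp [Pi.single_apply, Finset.sum_ite_eq', hP]
      have h4 : (load.prod val) (Pi.single P 1) = (load (Pi.single P 1), val (Pi.single P 1)) := rfl
      rw [h4, hφ, h2] at h1
      simp only [ite_mul, one_mul, zero_mul, Finset.sum_ite_mem, Finset.univ_inter] at h1
      rw [← Finset.sum_div, le_div_iff₀ hz0]
      nlinarith
  · left
    rw [Set.not_disjoint_iff] at hdisj
    obtain ⟨x, ⟨hx1, hx2⟩, f, hf, rfl⟩ := hdisj
    let f' : Finset (Sym2 W) → ℝ≥0 := fun P => ⟨f P, hf P⟩
    have hf' : ∀ P, (f' P : ℝ) = f P := fun P => rfl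
    have hpaths : ∀ u v, H.paths u v ⊆ H.paths v u := by
      intro u v P hP
      simp only [paths, Finset.mem_filter, Finset.mem_univ, true_and] at hP ⊢
      obtain ⟨p, hp, rfl⟩ := hP
      exact ⟨p.reverse, hp.reverse, by ext; simp⟩
    let D0 : ι → ι → ℝ≥0 := fun t t' => if t = t' then 0 else ∑ P ∈ H.paths (τ t) (τ t'), f' P
    have hval : ∑ t, ∑ t', (D0 t t' : ℝ) * δ t t' = val f := by
      refine Finset.sum_congr rfl fun t _ => Finset.sum_congr rfl fun t' _ => ?_
      by_cases h : t = t'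
      · subst h; simp [hδ0]
      · simp [D0, h, hf']
    change V < val f at hx2
    refine ⟨⟨D0, ?_, ?_, ?_⟩, ?_, ?_⟩
    · intro t t'
      by_cases h : t = t'
      · subst h; rfl
      · simp only [D0, h, Ne.symm h, if_false]
        rw [(hpaths (τ t) (τ t')).antisymm (hpaths (τ t') (τ t))]
    · intro t; simp [D0]
    · by_contra! hall
      rw [← hval] at hx2
      simp only [hall] at hx2
      simp at hx2
      linarith
    · refine iInf₂_le_of_le f' ?_ ?_
      · intro t t' h
        simp [D0, h]
      · refine iSup₂_le fun e he => ?_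
        have h1 := hx1 e
        change ∑ P ∈ (H.terminalPaths τ).filter (fun P => e ∈ P), f P < 3 * c e at h1
        have hce : c e = H.cap e := by simp [hc, he]
        have : (∑ P ∈ (H.terminalPaths τ).filter (fun P => e ∈ P), f' P) / H.cap e ≤ 3 := by
          have hpos' := hcpos e
          rw [hce] at h1 hpos'
          rw [div_le_iff₀ (by exact_mod_cast hpos')]
          rw [← NNReal.coe_le_coe]
          push_cast
          simp only [hf']
          exact h1.le
        exact_mod_cast this
    · rw [← hval] at hx2
      exact hx2

end CapGraph

/-! ### Congestion bounded below by distances -/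

namespace CapGraph

variable {W ι : Type*} [Fintype W] [DecidableEq W]

theorem mem_paths {H : CapGraph W} {u v : W} {P : Finset (Sym2 W)} :
    P ∈ H.paths u v ↔ ∃ p : H.graph.Walk u v, p.IsPath ∧ p.edges.toFinset = P := by
  classical
  simp only [paths, Finset.mem_filter, Finset.mem_univ, true_and]

/-- The edge set of a path determines its endpoints. -/
theorem endpoints_of_mem_paths {H : CapGraph W} {u v u' v' : W} {P : Finset (Sym2 W)}
    (huv : u ≠ v) (h : P ∈ H.paths u v) (h' : P ∈ H.paths u' v') :
    (u' = u ∧ v' = v) ∨ (u' = v ∧ v' = u) := by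
  obtain ⟨p, hp, hP⟩ := mem_paths.1 h
  obtain ⟨q, hq, hQ⟩ := mem_paths.1 h'
  have hperm : p.edges.Perm q.edges := by
    refine (List.perm_ext_iff_of_nodup hp.isTrail.edges_nodup hq.isTrail.edges_nodup).2 fun e => ?_
    rw [← List.mem_toFinset, ← List.mem_toFinset, hP, hQ]
  have hne : u' ≠ v' := by
    rintro rfl
    have hq0 : q = .nil := by simpa using hq
    subst hq0
    have hp0 : p.edges = [] := by simpa using hperm
    have := p.length_edges
    rw [hp0] at this
    exact huv (p.eq_of_length_eq_zero this.symm)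
  -- The endpoints are the vertices that meet an odd number of edges of the path.
  have key : ∀ x, (x ≠ u ∧ x ≠ v) ↔ (x ≠ u' ∧ x ≠ v') := by
    intro x
    have h1 := hp.isTrail.even_countP_edges_iff x
    have h2 := hq.isTrail.even_countP_edges_iff x
    rw [hperm.countP_eq] at h1
    simp only [ne_eq, huv, hne, not_false_eq_true, true_imp_iff] at h1 h2
    exact h1.symm.trans h2
  have a := key u
  have b := key v
  have a' := key u'
  have b' := key v'
  grind

theorem dist_le_card_of_mem_paths {H : CapGraph W} {u v : W} {P : Finset (Sym2 W)}
    (h : P ∈ H.paths u v) : H.graph.dist u v ≤ P.card := by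
  obtain ⟨p, hp, rfl⟩ := mem_paths.1 h
  rw [List.toFinset_card_of_nodup hp.isTrail.edges_nodup, p.length_edges]
  exact SimpleGraph.dist_le p

open Classical in
theorem mem_terminalPaths {H : CapGraph W} {τ : ι → W} {P : Finset (Sym2 W)} :
    P ∈ H.terminalPaths τ ↔ ∃ t t', P ∈ H.paths (τ t) (τ t') := by
  simp [terminalPaths]

/-- A demand between distant terminals has large congestion. -/
theorem sum_mul_dist_le [Fintype ι] (G : CapGraph W) {τ : ι → W} (hτ : Function.Injective τ)
    (D : Demand ι) (f : Finset (Sym2 W) → ℝ≥0) (hf : G.Routes τ f D) :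
    ∑ t, ∑ t', (D.val t t' : ℝ) * G.graph.dist (τ t) (τ t') ≤
      2 * ∑ P ∈ G.terminalPaths τ, (f P : ℝ) * P.card := by
  classical
  have h1 : ∀ t t', (D.val t t' : ℝ) * G.graph.dist (τ t) (τ t') ≤
      ∑ P ∈ G.terminalPaths τ,
        if t ≠ t' ∧ P ∈ G.paths (τ t) (τ t') then (f P : ℝ) * P.card else 0 := by
    intro t t'
    by_cases h : t = t'
    · subst h; simp
    · simp only [ne_eq, h, not_false_eq_true, true_and]
      rw [← hf t t' h, ← Finset.sum_filter]
      push_cast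
      rw [Finset.sum_mul]
      have : (G.terminalPaths τ).filter (fun P => P ∈ G.paths (τ t) (τ t'))
          = G.paths (τ t) (τ t') := by
        ext P
        simp only [Finset.mem_filter, mem_terminalPaths, and_iff_right_iff_imp]
        exact fun hP => ⟨t, t', hP⟩
      rw [this]
      refine Finset.sum_le_sum fun P hP => ?_
      have := dist_le_card_of_mem_paths hP
      gcongr
  calc _ ≤ ∑ t, ∑ t', ∑ P ∈ G.terminalPaths τ,
        (if t ≠ t' ∧ P ∈ G.paths (τ t) (τ t') then (f P : ℝ) * P.card else 0) :=
      Finset.sum_le_sum fun t _ => Finset.sum_le_sum fun t' _ => h1 t t'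
    _ = ∑ P ∈ G.terminalPaths τ, ∑ x : ι × ι,
        (if x.1 ≠ x.2 ∧ P ∈ G.paths (τ x.1) (τ x.2) then (f P : ℝ) * P.card else 0) := by
      rw [← Fintype.sum_prod_type' (f := fun t t' => ∑ P ∈ G.terminalPaths τ,
        (if t ≠ t' ∧ P ∈ G.paths (τ t) (τ t') then (f P : ℝ) * P.card else 0)), Finset.sum_comm]
    _ ≤ _ := by
      rw [Finset.mul_sum]
      refine Finset.sum_le_sum fun P _ => ?_
      rw [← Finset.sum_filter, Finset.sum_const, nsmul_eq_mul]
      have hnn : (0:ℝ) ≤ f P * P.card := by positivity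
      refine mul_le_mul_of_nonneg_right ?_ hnn
      -- A path serves at most the two orderings of a single pair; this is the factor `2`.
      rcases (Finset.univ.filter fun x : ι × ι =>
        x.1 ≠ x.2 ∧ P ∈ G.paths (τ x.1) (τ x.2)).eq_empty_or_nonempty with h0 | ⟨⟨a, b⟩, hab⟩
      · rw [h0]; simp
      · simp only [Finset.mem_filter, Finset.mem_univ, true_and] at hab
        have : (Finset.univ.filter fun x : ι × ι =>
            x.1 ≠ x.2 ∧ P ∈ G.paths (τ x.1) (τ x.2)) ⊆ {(a, b), (b, a)} := by
          rintro ⟨x, y⟩ hxy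
          simp only [Finset.mem_filter, Finset.mem_univ, true_and] at hxy
          rcases endpoints_of_mem_paths (fun h => hab.1 (hτ h)) hab.2 hxy.2 with ⟨h1, h2⟩ | ⟨h1, h2⟩
          · simp [hτ h1, hτ h2]
          · simp [hτ h1, hτ h2]
        exact_mod_cast (Finset.card_le_card this).trans Finset.card_le_two

open Classical in
/-- The congestion of a demand is at least its weighted distance divided by twice the total
capacity. -/
theorem le_cong_of_sum_dist [Fintype ι] (G : CapGraph W) {τ : ι → W} (hτ : Function.Injective τ)
    (D : Demand ι) {x : ℝ} (hx : 2 * x * ∑ e ∈ G.graph.edgeFinset, (G.cap e : ℝ) <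
      ∑ t, ∑ t', (D.val t t' : ℝ) * G.graph.dist (τ t) (τ t')) :
    ENNReal.ofReal x ≤ G.cong τ D := by
  refine le_iInf₂ fun f hf => ?_
  by_contra! hlt
  have hload : ∀ e ∈ G.graph.edgeFinset,
      ∑ P ∈ (G.terminalPaths τ).filter (fun P => e ∈ P), (f P : ℝ) ≤ x * G.cap e := by
    intro e he
    rw [SimpleGraph.mem_edgeFinset] at he
    have h1 := (le_iSup₂ (f := fun e (_ : e ∈ G.graph.edgeSet) =>
      (((∑ P ∈ (G.terminalPaths τ).filter (fun P => e ∈ P), f P) / G.cap e : ℝ≥0) : ℝ≥0∞)) e he)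
    have h2 := h1.trans_lt hlt
    rw [ENNReal.ofReal, ENNReal.coe_lt_coe, ← NNReal.coe_lt_coe] at h2
    have hc : (1 : ℝ) ≤ G.cap e := by exact_mod_cast G.one_le_cap e he
    have hx0 : 0 < x := by
      by_contra! hx0
      rw [Real.toNNReal_of_nonpos hx0] at h2
      exact absurd h2 (not_lt.2 (NNReal.coe_nonneg _))
    rw [Real.coe_toNNReal _ hx0.le] at h2
    push_cast at h2
    rw [div_lt_iff₀ (by linarith)] at h2
    exact h2.le
  have h3 : ∑ P ∈ G.terminalPaths τ, (f P : ℝ) * P.card ≤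
      ∑ e ∈ G.graph.edgeFinset, x * (G.cap e : ℝ) := by
    calc _ ≤ ∑ P ∈ G.terminalPaths τ, ∑ e ∈ G.graph.edgeFinset, if e ∈ P then (f P : ℝ) else 0 := by
          refine Finset.sum_le_sum fun P hP => ?_
          rw [← Finset.sum_filter, Finset.sum_const, nsmul_eq_mul, mul_comm]
          obtain ⟨t, t', hPt⟩ := mem_terminalPaths.1 hP
          obtain ⟨p, hp, rfl⟩ := mem_paths.1 hPt
          have hsub : p.edges.toFinset ⊆
              G.graph.edgeFinset.filter (fun e => e ∈ p.edges.toFinset) := by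
            intro e he
            simp only [Finset.mem_filter, he, and_true, SimpleGraph.mem_edgeFinset]
            exact p.edges_subset_edgeSet (by simpa using he)
          have hnn : (0:ℝ) ≤ f p.edges.toFinset := NNReal.coe_nonneg _
          refine mul_le_mul_of_nonneg_right ?_ hnn
          exact_mod_cast Finset.card_le_card hsub
      _ = ∑ e ∈ G.graph.edgeFinset,
            ∑ P ∈ (G.terminalPaths τ).filter (fun P => e ∈ P), (f P : ℝ) := by
          rw [Finset.sum_comm]
          exact Finset.sum_congr rfl fun e _ => (Finset.sum_filter _ _).symm
      _ ≤ _ := Finset.sum_le_sum hload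
  have h4 := sum_mul_dist_le G hτ D f hf
  rw [← Finset.mul_sum] at h3
  linarith

end CapGraph

/-! ### Large girth and local tree structure -/

namespace SimpleGraph

variable {V : Type*}

/-- Every edge is bypassed only by walks of length more than `g`, that is, all cycles have length
more than `g + 1`. -/
def BypassesLongerThan (G : SimpleGraph V) (g : ℕ) : Prop :=
  ∀ u v, G.Adj u v → ∀ p : G.Walk u v, s(u, v) ∉ p.edges → g < p.length

theorem exists_transfer_of_notMem_edge {G : SimpleGraph V} {x y a b : V}
    (p : (G ⊔ edge x y).Walk a b) (hp : s(x, y) ∉ p.edges) :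
    ∃ q : G.Walk a b, q.length = p.length ∧ q.edges = p.edges := by
  refine ⟨p.transfer G fun e he => ?_, by simp, by simp⟩
  have h1 := p.edges_subset_edgeSet he
  induction e with
  | _ c d =>
    rw [mem_edgeSet, sup_adj, edge_adj] at h1
    rcases h1 with h1 | ⟨⟨rfl, rfl⟩ | ⟨rfl, rfl⟩, _⟩
    · exact h1
    · exact absurd he hp
    · rw [Sym2.eq_swap] at he
      exact absurd he hp

theorem exists_split_of_mem_edge {G : SimpleGraph V} {x y a b : V}
    (p : (G ⊔ edge x y).Walk a b) (hp : p.IsPath) (hmem : s(x, y) ∈ p.edges) :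
    (∃ (p₁ : G.Walk a x) (p₂ : G.Walk y b), p₁.length + p₂.length + 1 ≤ p.length) ∨
    (∃ (p₁ : G.Walk a y) (p₂ : G.Walk x b), p₁.length + p₂.length + 1 ≤ p.length) := by
  induction p with
  | nil => simp at hmem
  | @cons a w b h q ih =>
    rw [Walk.cons_isPath_iff] at hp
    by_cases he : s(a, w) = s(x, y)
    · have hq : s(x, y) ∉ q.edges := by
        rw [← he]
        exact fun h' => hp.2 (Walk.fst_mem_support_of_mem_edges q h')
      obtain ⟨q', hq', _⟩ := exists_transfer_of_notMem_edge q hq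
      rw [Sym2.eq_iff] at he
      rcases he with ⟨rfl, rfl⟩ | ⟨rfl, rfl⟩
      · exact Or.inl ⟨.nil, q', by simp [hq']⟩
      · exact Or.inr ⟨.nil, q', by simp [hq']⟩
    · have hmem' : s(x, y) ∈ q.edges := by
        rw [Walk.edges_cons, List.mem_cons] at hmem
        exact hmem.resolve_left (Ne.symm he)
      have haw : G.Adj a w := by
        rw [sup_adj, edge_adj] at h
        rcases h with h | ⟨⟨rfl, rfl⟩ | ⟨rfl, rfl⟩, _⟩
        · exact h
        · exact absurd rfl he
        · exact absurd Sym2.eq_swap he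
      rcases ih hp.1 hmem' with ⟨p₁, p₂, hl⟩ | ⟨p₁, p₂, hl⟩
      · exact Or.inl ⟨.cons haw p₁, p₂, by simp only [Walk.length_cons]; omega⟩
      · exact Or.inr ⟨.cons haw p₁, p₂, by simp only [Walk.length_cons]; omega⟩

/-- A short bypass of an old edge `ab` through the new edge would split into two pieces which,
joined by `ab`, form a short walk from `x` to `y` in the old graph. -/
theorem BypassesLongerThan.sup_edge {G : SimpleGraph V} {g : ℕ} (hG : G.BypassesLongerThan g)
    {x y : V} (hxy : ∀ p : G.Walk x y, g < p.length) : (G ⊔ edge x y).BypassesLongerThan g := by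
  classical
  intro a b hab p hp
  have hyx : ∀ p : G.Walk y x, g < p.length := fun p => by simpa using hxy p.reverse
  have hle := p.length_bypass_le_length
  have hpe : s(a, b) ∉ p.bypass.edges := fun h => hp (p.edges_bypass_subset_edges h)
  have hpath := p.bypass_isPath
  generalize p.bypass = q at *
  refine lt_of_lt_of_le ?_ hle
  by_cases he : s(a, b) = s(x, y)
  · obtain ⟨q', hq', _⟩ := exists_transfer_of_notMem_edge q (he ▸ hpe)
    rw [← hq']
    rw [Sym2.eq_iff] at he
    rcases he with ⟨rfl, rfl⟩ | ⟨rfl, rfl⟩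
    · exact hxy q'
    · exact hyx q'
  · have hadj : G.Adj a b := by
      rw [sup_adj, edge_adj] at hab
      rcases hab with h | ⟨⟨rfl, rfl⟩ | ⟨rfl, rfl⟩, _⟩
      · exact h
      · exact absurd rfl he
      · exact absurd Sym2.eq_swap he
    by_cases hmem : s(x, y) ∈ q.edges
    · rcases exists_split_of_mem_edge q hpath hmem with ⟨p₁, p₂, hl⟩ | ⟨p₁, p₂, hl⟩
      · have := hxy (p₁.reverse.append (.cons hadj p₂.reverse))
        simp only [Walk.length_append, Walk.length_cons, Walk.length_reverse] at this
        omega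
      · have := hyx (p₁.reverse.append (.cons hadj p₂.reverse))
        simp only [Walk.length_append, Walk.length_cons, Walk.length_reverse] at this
        omega
    · obtain ⟨q', hq', hqe⟩ := exists_transfer_of_notMem_edge q hmem
      rw [← hq']
      exact hG a b hadj q' (hqe ▸ hpe)

/-- Vacuous: deleting the edge between `i` and `i + 1` separates the vertices up to `i` from the
rest, so no edge has a bypass. -/
theorem bypassesLongerThan_pathGraph (n g : ℕ) : (pathGraph n).BypassesLongerThan g := by
  have key : ∀ (i : ℕ) {a b : Fin n} (p : (pathGraph n).Walk a b),
      (∀ c d : Fin n, c.val = i → d.val = i + 1 → s(c, d) ∉ p.edges) →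
      (a.val ≤ i ↔ b.val ≤ i) := by
    intro i a b p
    induction p with
    | nil => simp
    | @cons a w b h q ih =>
      intro hp
      rw [← ih fun c d hc hd hcd => hp c d hc hd (by simp [hcd])]
      rw [pathGraph_adj] at h
      by_contra hne
      rcases h with h | h
      · exact hp a w (by omega) (by omega) (by simp)
      · exact hp w a (by omega) (by omega) (by simp [Sym2.eq_swap])
  intro u v huv p hp
  exfalso
  rw [pathGraph_adj] at huv
  rcases huv with h | h
  · have := key u p fun c d hc hd => by
      rw [Fin.ext hc, Fin.ext (hd.trans h)]; exact hp
    omega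
  · have := key v p fun c d hc hd => by
      rw [Fin.ext hc, Fin.ext (hd.trans h), Sym2.eq_swap]; exact hp
    omega

/-- Up to radius `h`, distances grow along every edge but at most one at each vertex. -/
def LocallyTree (G : SimpleGraph V) (h : ℕ) : Prop :=
  ∀ u x y z, G.Adj x y → G.Adj x z → y ≠ z → G.dist u x ≤ h →
    G.dist u y ≤ G.dist u x → G.dist u x < G.dist u z

/-- If neither `y` nor `z` is farther from `u` than `x`, geodesics from `u` to them avoid `x`;
together with `xy` they bypass the edge `xz` by a walk of length at most `2 * h + 1`. -/
theorem BypassesLongerThan.locallyTree {G : SimpleGraph V} (hc : G.Connected) {h : ℕ}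
    (hG : G.BypassesLongerThan (2 * h + 1)) : G.LocallyTree h := by
  classical
  intro u x y z hxy hxz hyz hux huy
  by_contra! huz
  have key : ∀ w, G.Adj x w → G.dist u w ≤ G.dist u x →
      ∃ p : G.Walk u w, p.length = G.dist u w ∧ x ∉ p.support := by
    intro w hxw huw
    obtain ⟨p, hp⟩ := hc.exists_walk_length_eq_dist u w
    refine ⟨p, hp, fun hx => ?_⟩
    have h1 := congrArg Walk.length (p.take_spec hx)
    rw [Walk.length_append] at h1
    have h2 := dist_le (p.takeUntil x hx)
    have h3 := dist_le (p.dropUntil x hx)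
    have h4 : G.dist x w = 1 := dist_eq_one_iff_adj.2 hxw
    omega
  obtain ⟨p, hp, hxp⟩ := key y hxy huy
  obtain ⟨q, hq, hxq⟩ := key z hxz huz
  have := hG x z hxz (.cons hxy (p.reverse.append q)) (by
    simp only [Walk.edges_cons, Walk.edges_append, Walk.edges_reverse, List.mem_cons,
      List.mem_append, List.mem_reverse, not_or]
    refine ⟨?_, fun h => hxp (Walk.fst_mem_support_of_mem_edges p h),
      fun h => hxq (Walk.fst_mem_support_of_mem_edges q h)⟩
    rw [Sym2.eq_iff]
    rintro (⟨_, h⟩ | ⟨h, _⟩)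
    · exact hyz h.symm
    · exact hxy.ne h)
  simp only [Walk.length_cons, Walk.length_append, Walk.length_reverse] at this
  omega

/-- Distances add up along a walk that does not turn back. -/
theorem LocallyTree.dist_add {G : SimpleGraph V} (hc : G.Connected) {h : ℕ} (hG : G.LocallyTree h)
    {u v x y : V} (hvx : G.Adj v x) (hux : G.dist u v < G.dist u x)
    (hyx : G.dist y x < G.dist y v) (hle : G.dist u x + G.dist y x ≤ h + 1) :
    G.dist u y = G.dist u x + G.dist y x := by
  obtain ⟨j, hj⟩ : ∃ j, G.dist y x = j := ⟨_, rfl⟩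
  induction j generalizing v x with
  | zero =>
    have : y = x := (hc.dist_eq_zero_iff).1 hj
    subst this
    simp
  | succ j ih =>
    obtain ⟨p, hp⟩ := hc.exists_walk_length_eq_dist x y
    rw [dist_comm, hj] at hp
    cases p with
    | nil => simp at hp
    | @cons _ x' _ hxx' q =>
      simp only [Walk.length_cons, add_left_inj] at hp
      have h1 : G.dist x' y ≤ j := hp ▸ dist_le q
      rw [dist_comm] at h1
      have hne : v ≠ x' := by rintro rfl; omega
      -- At `x` the one neighbour that is not farther from `u` is already `v`, so the geodesic to
      -- `y` continues away from `u`.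
      have h2 := hG u x v x' hvx.symm hxx' hne (by omega) hux.le
      have h3 : G.dist u x' ≤ G.dist u x + 1 := by
        have := hc.dist_triangle (u := u) (v := x) (w := x')
        rwa [dist_eq_one_iff_adj.2 hxx'] at this
      have h4 : G.dist y x ≤ G.dist y x' + 1 := by
        have := hc.dist_triangle (u := y) (v := x') (w := x)
        rwa [dist_eq_one_iff_adj.2 hxx'.symm] at this
      have := ih hxx' h2 (by omega) (by omega) (by omega)
      omega

section Balls

variable [Fintype V]

open Classical in
theorem card_ball_le {G : SimpleGraph V} (hc : G.Connected) {K : ℕ}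
    (hK : ∀ v, (Finset.univ.filter (G.Adj v)).card ≤ K) (u : V) (ρ : ℕ) :
    (Finset.univ.filter fun v => G.dist u v ≤ ρ).card ≤ (K + 1) ^ ρ := by
  induction ρ with
  | zero =>
    rw [pow_zero, Finset.card_le_one]
    intro a ha b hb
    simp only [nonpos_iff_eq_zero, Finset.mem_filter, Finset.mem_univ, true_and] at ha hb
    rw [← (hc.dist_eq_zero_iff).1 ha, ← (hc.dist_eq_zero_iff).1 hb]
  | succ ρ ih =>
    have hsub : (Finset.univ.filter fun v => G.dist u v ≤ ρ + 1) ⊆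
        (Finset.univ.filter fun v => G.dist u v ≤ ρ).biUnion
          fun v => insert v (Finset.univ.filter (G.Adj v)) := by
      intro v hv
      simp only [Finset.mem_filter, Finset.mem_univ, true_and] at hv
      simp only [Finset.mem_biUnion, Finset.mem_filter, Finset.mem_univ, true_and,
        Finset.mem_insert]
      by_cases h : G.dist u v ≤ ρ
      · exact ⟨v, h, Or.inl rfl⟩
      · obtain ⟨p, hp⟩ := hc.exists_walk_length_eq_dist v u
        rw [dist_comm] at hp
        cases p with
        | nil => simp at h
        | @cons _ w _ hvw q =>
          simp only [Walk.length_cons] at hp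
          refine ⟨w, ?_, Or.inr hvw.symm⟩
          have := dist_le q
          rw [dist_comm] at this
          omega
    refine (Finset.card_le_card hsub).trans (Finset.card_biUnion_le.trans ?_)
    calc _ ≤ ∑ v ∈ Finset.univ.filter (fun v => G.dist u v ≤ ρ), (K + 1) :=
          Finset.sum_le_sum fun v _ => (Finset.card_insert_le _ _).trans (by
            have := hK v; omega)
      _ ≤ (K + 1) ^ (ρ + 1) := by
          rw [Finset.sum_const, smul_eq_mul, pow_succ]
          gcongr

-- Below radius `h` each vertex has at most one neighbour that is not a child, and no child has two
-- parents, so spheres grow as in a tree.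
open Classical in
theorem LocallyTree.pow_le_card_sphere {G : SimpleGraph V} (hc : G.Connected) {h d : ℕ}
    (hG : G.LocallyTree h) (u : V) (ρ : ℕ) (hρ : ρ ≤ h)
    (hd : ∀ v, G.dist u v < ρ → d + 1 ≤ (Finset.univ.filter (G.Adj v)).card) :
    d ^ ρ ≤ (Finset.univ.filter fun v => G.dist u v = ρ).card := by
  induction ρ with
  | zero =>
    rw [pow_zero, Nat.one_le_iff_ne_zero, Finset.card_ne_zero]
    exact ⟨u, by simp⟩
  | succ ρ ih =>
    have ih' := ih (by omega) fun v hv => hd v (by omega)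
    set S := Finset.univ.filter fun v => G.dist u v = ρ with hS
    set S' := Finset.univ.filter fun v => G.dist u v = ρ + 1 with hS'
    have hstep : ∀ x y, G.Adj x y → G.dist u y ≤ G.dist u x + 1 := by
      intro x y hxy
      have := hc.dist_triangle (u := u) (v := x) (w := y)
      rwa [dist_eq_one_iff_adj.2 hxy] at this
    have h1 : ∀ x ∈ S, d ≤ (S'.filter (G.Adj x)).card := by
      intro x hx
      simp only [hS, Finset.mem_filter, Finset.mem_univ, true_and] at hx
      have h2 := hd x (by omega)
      have h3 : (Finset.univ.filter (G.Adj x)) ⊆ S'.filter (G.Adj x) ∪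
          Finset.univ.filter (fun y => G.Adj x y ∧ G.dist u y ≤ G.dist u x) := by
        intro y hy
        simp only [Finset.mem_filter, Finset.mem_univ, true_and] at hy
        simp only [hS', Finset.mem_union, Finset.mem_filter, Finset.mem_univ, true_and, hy, and_true]
        have := hstep x y hy
        omega
      have h4 : (Finset.univ.filter (fun y => G.Adj x y ∧ G.dist u y ≤ G.dist u x)).card ≤ 1 := by
        rw [Finset.card_le_one]
        intro y hy z hz
        simp only [Finset.mem_filter, Finset.mem_univ, true_and] at hy hz
        by_contra hyz
        have := hG u x y z hy.1 hz.1 hyz (by omega) hy.2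
        omega
      have h5 := (Finset.card_le_card h3).trans (Finset.card_union_le _ _)
      omega
    have hdisj : (S : Set V).PairwiseDisjoint fun x => S'.filter (G.Adj x) := by
      intro x hx z hz hxz
      simp only [hS, Finset.coe_filter, Finset.mem_univ, true_and, Set.mem_ofPred_eq] at hx hz
      rw [Function.onFun, Finset.disjoint_left]
      intro y hy hy'
      simp only [hS', Finset.mem_filter, Finset.mem_univ, true_and] at hy hy'
      have := hG u y x z hy.2.symm hy'.2.symm hxz (by omega) (by omega)
      omega
    calc d ^ (ρ + 1) = d ^ ρ * d := pow_succ _ _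
      _ ≤ S.card * d := by gcongr
      _ ≤ ∑ x ∈ S, (S'.filter (G.Adj x)).card := by
          rw [← smul_eq_mul, ← Finset.sum_const]
          exact Finset.sum_le_sum h1
      _ = (S.biUnion fun x => S'.filter (G.Adj x)).card := (Finset.card_biUnion hdisj).symm
      _ ≤ S'.card := Finset.card_le_card (Finset.biUnion_subset.2 fun x _ => Finset.filter_subset _ _)

end Balls

end SimpleGraph

/-! ### Maximal edge-coloured graphs of large girth -/

namespace SimpleGraph

/-- The graph formed by a Hamiltonian path together with all pairs matched by the permutations. -/
def pathSupMatchings {n Δ : ℕ} (π : Fin Δ → Equiv.Perm (Fin n)) : SimpleGraph (Fin n) :=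
  pathGraph n ⊔ fromRel fun x y => ∃ a, π a x = y

/-- A family of matchings that are disjoint and create no short cycles. -/
structure IsSparseMatching {n Δ : ℕ} (g : ℕ) (π : Fin Δ → Equiv.Perm (Fin n)) : Prop where
  invol : ∀ a v, π a (π a v) = v
  inj : ∀ a b v, π a v = π b v → π a v ≠ v → a = b
  bypass : (pathSupMatchings π).BypassesLongerThan g

theorem pathSupMatchings_connected {n Δ : ℕ} (hn : 0 < n) (π : Fin Δ → Equiv.Perm (Fin n)) :
    (pathSupMatchings π).Connected := by
  obtain ⟨m, rfl⟩ : ∃ m, n = m + 1 := ⟨n - 1, by omega⟩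
  exact (pathGraph_connected m).mono le_sup_left

theorem pathSupMatchings_adj {n Δ : ℕ} {π : Fin Δ → Equiv.Perm (Fin n)}
    (hπ : ∀ a v, π a (π a v) = v) {x y : Fin n} :
    (pathSupMatchings π).Adj x y ↔ (pathGraph n).Adj x y ∨ (x ≠ y ∧ ∃ a, π a x = y) := by
  rw [pathSupMatchings, sup_adj, fromRel_adj]
  have : (∃ a, π a y = x) ↔ ∃ a, π a x = y :=
    ⟨fun ⟨a, h⟩ => ⟨a, by rw [← h, hπ]⟩, fun ⟨a, h⟩ => ⟨a, by rw [← h, hπ]⟩⟩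
  rw [this, or_self]

theorem isSparseMatching_one (n Δ g : ℕ) :
    IsSparseMatching g (fun _ => 1 : Fin Δ → Equiv.Perm (Fin n)) := by
  refine ⟨fun _ _ => rfl, fun _ _ _ _ h => absurd rfl h, ?_⟩
  have : pathSupMatchings (fun _ => 1 : Fin Δ → Equiv.Perm (Fin n)) = pathGraph n := by
    ext x y
    rw [pathSupMatchings_adj fun _ _ => rfl]
    simp only [ne_eq, Equiv.Perm.coe_one, id_eq, exists_const_iff, or_iff_left_iff_imp]
    rintro ⟨h1, _, h2⟩
    exact absurd h2 h1
  rw [this]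
  exact bypassesLongerThan_pathGraph n g

/-- The augmentation step of the extremal argument: matching two distant free vertices in colour `a`
adds one edge, which closes only long cycles and lies in no other colour. -/
theorem IsSparseMatching.update {n Δ g : ℕ} (hg : 1 ≤ g) {π : Fin Δ → Equiv.Perm (Fin n)}
    (hπ : IsSparseMatching g π) {a : Fin Δ} {x y : Fin n} (hx : π a x = x) (hy : π a y = y)
    (hdist : g < (pathSupMatchings π).dist x y) :
    IsSparseMatching g (Function.update π a (π a * Equiv.swap x y)) := by
  have hxy : x ≠ y := by rintro rfl; simp at hdist
  have hnadj : ¬ (pathSupMatchings π).Adj x y := fun h => by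
    rw [dist_eq_one_iff_adj.2 h] at hdist
    omega
  have hno : ∀ b, π b x ≠ y := fun b hb =>
    hnadj ((pathSupMatchings_adj hπ.invol).2 (Or.inr ⟨hxy, b, hb⟩))
  have hno' : ∀ b, π b y ≠ x := fun b hb => hno b (by rw [← hb, hπ.invol])
  have hvx : Function.update π a (π a * Equiv.swap x y) a x = y := by simp [hy]
  have hvy : Function.update π a (π a * Equiv.swap x y) a y = x := by simp [hx]
  have hv : ∀ v, v ≠ x → v ≠ y → Function.update π a (π a * Equiv.swap x y) a v = π a v := by
    intro v h1 h2
    simp [Equiv.swap_apply_of_ne_of_ne h1 h2]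
  have hb : ∀ b v, b ≠ a → Function.update π a (π a * Equiv.swap x y) b v = π b v := by
    intro b v hb
    simp [hb]
  have hinvol : ∀ b v, Function.update π a (π a * Equiv.swap x y) b
      (Function.update π a (π a * Equiv.swap x y) b v) = v := by
    intro b v
    by_cases hba : b = a
    · subst hba
      by_cases h1 : v = x
      · subst h1; rw [hvx, hvy]
      by_cases h2 : v = y
      · subst h2; rw [hvy, hvx]
      have h3 : π b v ≠ x := fun h => h1 (by rw [← hπ.invol b v, h, hx])
      have h4 : π b v ≠ y := fun h => h2 (by rw [← hπ.invol b v, h, hy])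
      rw [hv v h1 h2, hv _ h3 h4, hπ.invol]
    · rw [hb b _ hba, hb b _ hba, hπ.invol]
  refine ⟨hinvol, ?_, ?_⟩
  · have key : ∀ c v, c ≠ a → Function.update π a (π a * Equiv.swap x y) a v = π c v →
        π c v ≠ v → a = c := by
      intro c v hc h h'
      by_cases h1 : v = x
      · subst h1; rw [hvx] at h; exact absurd h.symm (hno c)
      by_cases h2 : v = y
      · subst h2; rw [hvy] at h; exact absurd h.symm (hno' c)
      rw [hv v h1 h2] at h
      exact hπ.inj a c v h (h ▸ h')
    intro b c v h h'
    by_cases hba : b = a <;> by_cases hca : c = a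
    · rw [hba, hca]
    · subst hba
      rw [h, hb c v hca] at h'
      rw [hb c v hca] at h
      exact key c v hca h h'
    · subst hca
      rw [hb b v hba] at h h'
      exact (key b v hba h.symm h').symm
    · rw [hb b v hba, hb c v hca] at h
      rw [hb b v hba] at h'
      exact hπ.inj b c v h h'
  · have : pathSupMatchings (Function.update π a (π a * Equiv.swap x y)) =
        pathSupMatchings π ⊔ edge x y := by
      ext u v
      rw [sup_adj, edge_adj, pathSupMatchings_adj hπ.invol, pathSupMatchings_adj hinvol, or_assoc]
      refine or_congr_right ?_
      constructor
      · rintro ⟨huv, b, h⟩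
        by_cases hba : b = a
        · subst hba
          by_cases h1 : u = x
          · subst h1; rw [hvx] at h; exact Or.inr ⟨Or.inl ⟨rfl, h.symm⟩, huv⟩
          by_cases h2 : u = y
          · subst h2; rw [hvy] at h; exact Or.inr ⟨Or.inr ⟨rfl, h.symm⟩, huv⟩
          rw [hv u h1 h2] at h
          exact Or.inl ⟨huv, b, h⟩
        · rw [hb b u hba] at h
          exact Or.inl ⟨huv, b, h⟩
      · rintro (⟨huv, b, h⟩ | ⟨⟨rfl, rfl⟩ | ⟨rfl, rfl⟩, huv⟩)
        · refine ⟨huv, b, ?_⟩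
          by_cases hba : b = a
          · subst hba
            by_cases h1 : u = x
            · subst h1; exact absurd (hx.symm.trans h) huv
            by_cases h2 : u = y
            · subst h2; exact absurd (hy.symm.trans h) huv
            rw [hv u h1 h2, h]
          · rw [hb b u hba, h]
        · exact ⟨huv, a, hvx⟩
        · exact ⟨huv, a, hvy⟩
    rw [this]
    exact hπ.bypass.sup_edge fun p => hdist.trans_le (dist_le p)

open Classical in
theorem card_adj_pathSupMatchings_le {n Δ : ℕ} {π : Fin Δ → Equiv.Perm (Fin n)}
    (hπ : ∀ a v, π a (π a v) = v) (v : Fin n) :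
    (Finset.univ.filter ((pathSupMatchings π).Adj v)).card ≤ Δ + 2 := by
  have hsub : Finset.univ.filter ((pathSupMatchings π).Adj v) ⊆
      Finset.univ.image (fun a => π a v) ∪
        (Finset.univ.filter (fun w : Fin n => v.val + 1 = w.val) ∪
          Finset.univ.filter (fun w : Fin n => w.val + 1 = v.val)) := by
    intro w hw
    simp only [Finset.mem_filter, Finset.mem_univ, true_and, pathSupMatchings_adj hπ,
      pathGraph_adj] at hw
    simp only [Finset.mem_union, Finset.mem_image, Finset.mem_univ, true_and, Finset.mem_filter]
    tauto
  have h1 : (Finset.univ.image (fun a => π a v)).card ≤ Δ :=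
    Finset.card_image_le.trans (by simp)
  have h2 : (Finset.univ.filter (fun w : Fin n => v.val + 1 = w.val)).card ≤ 1 := by
    rw [Finset.card_le_one]
    intro x hx y hy
    simp only [Finset.mem_filter, Finset.mem_univ, true_and] at hx hy
    exact Fin.ext (hx.symm.trans hy)
  have h3 : (Finset.univ.filter (fun w : Fin n => w.val + 1 = v.val)).card ≤ 1 := by
    rw [Finset.card_le_one]
    intro x hx y hy
    simp only [Finset.mem_filter, Finset.mem_univ, true_and] at hx hy
    exact Fin.ext (by omega)
  have h4 := Finset.card_le_card hsub
  have h5 := Finset.card_union_le (Finset.univ.image (fun a => π a v))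
    (Finset.univ.filter (fun w : Fin n => v.val + 1 = w.val) ∪
          Finset.univ.filter (fun w : Fin n => w.val + 1 = v.val))
  have h6 := Finset.card_union_le (Finset.univ.filter (fun w : Fin n => v.val + 1 = w.val))
    (Finset.univ.filter (fun w : Fin n => w.val + 1 = v.val))
  omega

open Classical in
/-- There are almost regular edge-coloured graphs of large girth. -/
theorem exists_isSparseMatching (n Δ g : ℕ) (hn : 0 < n) (hg : 1 ≤ g) :
    ∃ π : Fin Δ → Equiv.Perm (Fin n), IsSparseMatching g π ∧
      ∀ a, (Finset.univ.filter fun v => π a v = v).card ≤ (Δ + 3) ^ g := by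
  -- Match as many vertices as possible. Any two vertices left free in one colour are then at
  -- distance at most `g`, so they all lie in one ball.
  obtain ⟨π, hπ, hmax⟩ := Set.exists_max_image
    {π : Fin Δ → Equiv.Perm (Fin n) | IsSparseMatching g π}
    (fun π => ∑ b, (Finset.univ.filter fun v => π b v ≠ v).card) (Set.toFinite _)
    ⟨_, isSparseMatching_one n Δ g⟩
  refine ⟨π, hπ, fun a => ?_⟩
  rcases (Finset.univ.filter fun v => π a v = v).eq_empty_or_nonempty with h0 | ⟨x, hx⟩
  · rw [h0]; simp
  simp only [Finset.mem_filter, Finset.mem_univ, true_and] at hx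
  refine le_trans (Finset.card_le_card ?_) (card_ball_le (pathSupMatchings_connected hn π)
    (card_adj_pathSupMatchings_le hπ.invol) x g)
  intro y hy
  simp only [Finset.mem_filter, Finset.mem_univ, true_and] at hy ⊢
  by_contra! hlt
  have hxy : x ≠ y := by rintro rfl; simp at hlt
  refine absurd (hmax _ (hπ.update hg hx hy hlt)) (not_le.2 ?_)
  refine Finset.sum_lt_sum (fun b _ => ?_) ⟨a, Finset.mem_univ a, ?_⟩
  · refine Finset.card_le_card fun v hv => ?_
    simp only [Finset.mem_filter, Finset.mem_univ, true_and] at hv ⊢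
    by_cases hb : b = a
    · subst hb
      have h1 : v ≠ x := by rintro rfl; exact hv hx
      have h2 : v ≠ y := by rintro rfl; exact hv hy
      simpa [Equiv.swap_apply_of_ne_of_ne h1 h2] using hv
    · simpa [hb] using hv
  · refine Finset.card_lt_card (Finset.ssubset_iff_of_subset (fun v hv => ?_) |>.2 ⟨x, ?_, ?_⟩)
    · simp only [Finset.mem_filter, Finset.mem_univ, true_and] at hv ⊢
      have h1 : v ≠ x := by rintro rfl; exact hv hx
      have h2 : v ≠ y := by rintro rfl; exact hv hy
      simpa [Equiv.swap_apply_of_ne_of_ne h1 h2] using hv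
    · simp [hy, hxy.symm]
    · simp [hx]

end SimpleGraph

/-! ### Nets -/

open Classical in
/-- If balls of radius `ρ` around the points of `S` are large, then `S` is dominated at distance
`2 * ρ` by few vertices. -/
theorem SimpleGraph.Connected.exists_net {V : Type*} [Fintype V] {G : SimpleGraph V}
    (hc : G.Connected) (S : Finset V) {ρ b k : ℕ} (hb : 0 < b)
    (hball : ∀ u ∈ S, b ≤ (Finset.univ.filter fun v => G.dist u v ≤ ρ).card)
    (hk : Fintype.card V ≤ b * k) (hkV : k ≤ Fintype.card V) :
    ∃ T : Finset V, T.card = k ∧ ∀ u ∈ S, ∃ t ∈ T, G.dist u t ≤ 2 * ρ := by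
  -- A largest subset with pairwise distances above `2 * ρ`: its balls are disjoint, which bounds
  -- its size by `k`, and maximality makes it dominate `S`. Padding gives size exactly `k`.
  obtain ⟨A, hA, hmax⟩ := Finset.exists_max_image
    (S.powerset.filter fun A => ∀ x ∈ A, ∀ y ∈ A, x ≠ y → 2 * ρ < G.dist x y) Finset.card
    ⟨∅, by simp⟩
  simp only [Finset.mem_filter, Finset.mem_powerset] at hA hmax
  have hdisj : (A : Set V).PairwiseDisjoint fun u => Finset.univ.filter fun v => G.dist u v ≤ ρ := by
    intro x hx y hy hxy
    rw [Function.onFun, Finset.disjoint_left]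
    intro v hv hv'
    simp only [Finset.mem_filter, Finset.mem_univ, true_and] at hv hv'
    have h1 := hA.2 x hx y hy hxy
    have h2 := hc.dist_triangle (u := x) (v := v) (w := y)
    rw [SimpleGraph.dist_comm (u := v)] at h2
    omega
  have hcard : A.card * b ≤ Fintype.card V := by
    rw [← smul_eq_mul, ← Finset.sum_const]
    refine (Finset.sum_le_sum fun u hu => hball u (hA.1 hu)).trans ?_
    rw [← Finset.card_biUnion hdisj]
    exact Finset.card_le_univ _
  have hAk : A.card ≤ k := by
    by_contra! h
    have := Nat.mul_lt_mul_of_pos_right h hb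
    rw [mul_comm k] at this
    omega
  obtain ⟨T, hAT, hT⟩ := Finset.exists_superset_card_eq hAk hkV
  refine ⟨T, hT, fun u hu => ?_⟩
  by_contra! hfar
  have huA : u ∉ A := fun h => by
    have := hfar u (hAT h)
    simp at this
  have := hmax (insert u A) ⟨Finset.insert_subset hu hA.1, by
    intro x hx y hy hxy
    rw [Finset.mem_insert] at hx hy
    rcases hx with rfl | hx <;> rcases hy with rfl | hy
    · exact absurd rfl hxy
    · exact hfar y (hAT hy)
    · rw [SimpleGraph.dist_comm]; exact hfar x (hAT hx)
    · exact hA.2 x hx y hy hxy⟩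
  rw [Finset.card_insert_of_notMem huA] at this
  omega

/-! ### Permutations within clusters that move most vertices far -/

section NearPermutation

-- Average over the cyclic shifts of `V`: each ordered pair occurs in exactly one shift, so a shift
-- has at most `B` near pairs on average.
open Classical in
theorem exists_perm_card_near_le {V : Type*} [Fintype V] (near : V → V → Prop) {B : ℕ}
    (hB : ∀ u, (Finset.univ.filter (near u)).card ≤ B) :
    ∃ σ : Equiv.Perm V, (Finset.univ.filter fun u => near u (σ u)).card ≤ B := by
  cases isEmpty_or_nonempty V with
  | inl h => exact ⟨1, by simp [Finset.univ_eq_empty]⟩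
  | inr h =>
    obtain ⟨s, hs⟩ : ∃ s, Fintype.card V = s + 1 := ⟨Fintype.card V - 1, by
      have := Fintype.card_pos (α := V); omega⟩
    let e : V ≃ Fin (s + 1) := Fintype.equivFinOfCardEq hs
    let τ : Fin (s + 1) → Equiv.Perm V := fun j => (e.trans (Equiv.addLeft j)).trans e.symm
    have hsum : ∑ j, (Finset.univ.filter fun u => near u (τ j u)).card ≤
        ∑ _j : Fin (s + 1), B := by
      simp only [Finset.card_filter]
      have hconst : ∑ _j : Fin (s + 1), B = ∑ _u : V, B := by simp [hs]
      rw [Finset.sum_comm, hconst]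
      refine Finset.sum_le_sum fun u _ => ?_
      have : ∑ j, (if near u (τ j u) then 1 else 0) = ∑ v, if near u v then 1 else 0 :=
        Equiv.sum_comp ((Equiv.addRight (e u)).trans e.symm) fun v => if near u v then 1 else 0
      rw [this, ← Finset.card_filter]
      exact hB u
    obtain ⟨j, _, hj⟩ := Finset.exists_le_of_sum_le Finset.univ_nonempty hsum
    exact ⟨τ j, hj⟩

open Classical in
/-- There is a permutation that preserves the clusters, and moves few points to near points. -/
theorem exists_perm_cluster_card_near_le {V K : Type*} [Fintype V] [Fintype K] (cl : V → K)
    (near : V → V → Prop) {B : ℕ} (hB : ∀ u, (Finset.univ.filter (near u)).card ≤ B) :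
    ∃ σ : Equiv.Perm V, (∀ u, cl (σ u) = cl u) ∧
      (Finset.univ.filter fun u => near u (σ u)).card ≤ Fintype.card K * B := by
  have h (k : K) : ∃ σ : Equiv.Perm {v // cl v = k},
      (Finset.univ.filter fun u : {v // cl v = k} => near u (σ u)).card ≤ B := by
    refine exists_perm_card_near_le (fun u v : {v // cl v = k} => near u v) fun u => ?_
    refine le_trans ?_ (hB u)
    refine Finset.card_le_card_of_injOn Subtype.val ?_ Subtype.val_injective.injOn
    intro v hv
    simpa using hv
  choose τ hτ using h
  let σ : Equiv.Perm V := ((Equiv.sigmaFiberEquiv cl).symm.trans (Equiv.sigmaCongrRight τ)).trans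
    (Equiv.sigmaFiberEquiv cl)
  have hσ : ∀ k (u : {v // cl v = k}), σ u = τ k u := by
    rintro k ⟨u, rfl⟩
    rfl
  refine ⟨σ, fun u => ?_, ?_⟩
  · rw [hσ (cl u) ⟨u, rfl⟩]
    exact (τ (cl u) ⟨u, rfl⟩).2
  · have : (Finset.univ.filter fun u => near u (σ u)) ⊆ Finset.univ.biUnion fun k =>
        (Finset.univ.filter fun u : {v // cl v = k} => near u (τ k u)).image Subtype.val := by
      intro u hu
      simp only [Finset.mem_filter, Finset.mem_univ, true_and] at hu
      simp only [Finset.mem_biUnion, Finset.mem_univ, true_and, Finset.mem_image,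
        Finset.mem_filter]
      exact ⟨cl u, ⟨u, rfl⟩, by rwa [← hσ], rfl⟩
    refine (Finset.card_le_card this).trans (Finset.card_biUnion_le.trans ?_)
    rw [← Finset.card_univ, ← smul_eq_mul, ← Finset.sum_const]
    exact Finset.sum_le_sum fun k _ => Finset.card_image_le.trans (hτ k)

-- Bad vertices are left fixed, so that a trajectory makes jumps only between good vertices, where
-- distances are under control.
open Classical in
theorem exists_perm_cluster_fixing_card_near_le {V K : Type*} [Fintype V] [Fintype K] (cl : V → K)
    (good : V → Prop) (near : V → V → Prop) {B : ℕ}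
    (hB : ∀ u, (Finset.univ.filter (near u)).card ≤ B) :
    ∃ σ : Equiv.Perm V, (∀ u, cl (σ u) = cl u) ∧ (∀ u, good u → good (σ u)) ∧
      (∀ u, ¬ good u → σ u = u) ∧
      (Finset.univ.filter fun u => good u ∧ near u (σ u)).card ≤ Fintype.card K * B := by
  obtain ⟨τ, h1, h2⟩ := exists_perm_cluster_card_near_le (V := {v // good v}) (fun v => cl v)
    (fun u v => near u v) (B := B) fun u => by
      refine le_trans ?_ (hB u)
      refine Finset.card_le_card_of_injOn Subtype.val ?_ Subtype.val_injective.injOn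
      intro v hv
      simpa using hv
  have hg : ∀ u (hu : good u), Equiv.Perm.ofSubtype τ u = τ ⟨u, hu⟩ := fun u hu =>
    Equiv.Perm.ofSubtype_apply_of_mem τ hu
  have hng : ∀ u, ¬ good u → Equiv.Perm.ofSubtype τ u = u := fun u hu =>
    Equiv.Perm.ofSubtype_apply_of_not_mem τ hu
  refine ⟨Equiv.Perm.ofSubtype τ, fun u => ?_, fun u hu => ?_, hng, ?_⟩
  · by_cases hu : good u
    · rw [hg u hu]; exact h1 ⟨u, hu⟩
    · rw [hng u hu]
  · rw [hg u hu]; exact (τ ⟨u, hu⟩).2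
  · refine le_trans ?_ h2
    rw [← Finset.card_map (Function.Embedding.subtype good)]
    refine Finset.card_le_card fun u hu => ?_
    simp only [Finset.mem_filter, Finset.mem_univ, true_and] at hu
    simp only [Finset.mem_map, Finset.mem_filter, Finset.mem_univ, true_and]
    exact ⟨⟨u, hu.1⟩, by simpa only [hg u hu.1] using hu.2, rfl⟩

end NearPermutation

/-! ### Random trajectories -/

section Trajectories

variable {V A : Type*}

/-- The position after `i` steps, where a step applies `σ` and then the permutation `π (a i)`. -/
def trajectory (σ : Equiv.Perm V) (π : A → Equiv.Perm V) (a : ℕ → A) : ℕ → Equiv.Perm V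
  | 0 => 1
  | i + 1 => π (a i) * (σ * trajectory σ π a i)

theorem trajectory_congr (σ : Equiv.Perm V) (π : A → Equiv.Perm V) {a b : ℕ → A} {i : ℕ}
    (h : ∀ j < i, a j = b j) : trajectory σ π a i = trajectory σ π b i := by
  induction i with
  | zero => rfl
  | succ i ih =>
    rw [trajectory, trajectory, h i (by omega), ih fun j hj => h j (by omega)]

/-- Extension of a finite sequence by its first term. -/
def extendSeq {m : ℕ} (a : Fin (m + 1) → A) (i : ℕ) : A :=
  if h : i < m + 1 then a ⟨i, h⟩ else a 0

theorem extendSeq_val {m : ℕ} (a : Fin (m + 1) → A) (i : Fin (m + 1)) : extendSeq a i = a i :=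
  dif_pos i.2

theorem sum_insertNth [Fintype A] {m : ℕ} (i : Fin (m + 1)) (f : (Fin (m + 1) → A) → ℝ) :
    ∑ a, f a = ∑ b : Fin m → A, ∑ c : A, f (i.insertNth c b) := by
  rw [← Equiv.sum_comp (Fin.insertNthEquiv (fun _ => A) i), Fintype.sum_prod_type, Finset.sum_comm]
  rfl

open Classical in
/-- First moment method for trajectories with a uniformly random starting point and uniformly random
steps: the position at each time is uniformly distributed. -/
theorem exists_trajectory [Fintype V] [Fintype A] (σ : Equiv.Perm V)
    (π : A → Equiv.Perm V) (m : ℕ) (g : V → ℝ) (hg : ∀ v, 0 ≤ g v) (F : V → A → ℝ)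
    (hF : ∀ v c, 0 ≤ F v c) (back : V → V → A → Prop)
    (hback : ∀ x v, (Finset.univ.filter (back x v)).card ≤ 1)
    (hsum : Fintype.card A * ∑ v, g v + (m + 1) * ∑ v, ∑ c, F v c + (m + 1) * Fintype.card V <
      Fintype.card A * Fintype.card V) :
    ∃ (u : ℕ → V) (c : ℕ → A), (∀ i, u (i + 1) = π (c i) (σ (u i))) ∧
      g (u 0) + ∑ i ∈ Finset.range (m + 1), F (u i) (c i) < 1 ∧
      ∀ i ≤ m, ¬ back (u 0) (u i) (c i) := by
  set N : ℝ := (Fintype.card V : ℝ)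
  set q : ℝ := (Fintype.card A : ℝ)
  let u : (Fin (m + 1) → A) → V → ℕ → V := fun a x i => trajectory σ π (extendSeq a) i x
  have hcardb : (Fintype.card (Fin m → A) : ℝ) = q ^ m := by simp [q]
  let Φ : (Fin (m + 1) → A) → V → ℝ := fun a x => g x + ∑ i : Fin (m + 1),
    (F (u a x i) (a i) + if back x (u a x i) (a i) then 1 else 0)
  have h1 : ∑ a : Fin (m + 1) → A, ∑ x, g x = q ^ m * (q * ∑ v, g v) := by
    rw [Finset.sum_const, Finset.card_univ, nsmul_eq_mul]
    simp only [Fintype.card_fun, Fintype.card_fin]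
    push_cast
    ring
  have h2 : ∀ i : Fin (m + 1), ∑ a : Fin (m + 1) → A, ∑ x, F (u a x i) (a i) =
      q ^ m * ∑ v, ∑ c, F v c := by
    intro i
    -- For fixed choices the position at time `i` is a bijective function of the start, hence
    -- uniformly distributed.
    have : ∀ a : Fin (m + 1) → A, ∑ x, F (u a x i) (a i) = ∑ v, F v (a i) := fun a =>
      Equiv.sum_comp (trajectory σ π (extendSeq a) i) fun v => F v (a i)
    simp only [this]
    rw [sum_insertNth i]
    simp only [Fin.insertNth_apply_same]
    rw [Finset.sum_const, Finset.card_univ, nsmul_eq_mul, hcardb, Finset.sum_comm]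
  have h3 : ∀ i : Fin (m + 1), ∑ a : Fin (m + 1) → A, ∑ x,
      (if back x (u a x i) (a i) then (1 : ℝ) else 0) ≤ q ^ m * N := by
    intro i
    rw [sum_insertNth i, ← hcardb, ← nsmul_eq_mul, ← Finset.card_univ, ← Finset.sum_const]
    refine Finset.sum_le_sum fun b _ => ?_
    rw [Finset.sum_comm]
    have : N = ∑ _x : V, (1 : ℝ) := by simp [N]
    rw [this]
    refine Finset.sum_le_sum fun x _ => ?_
    simp only [Fin.insertNth_apply_same]
    -- The position at time `i` depends only on earlier choices, so once the others are fixed at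
    -- most one value of the `i`-th choice is bad. This handles an event involving the start, which
    -- `F` cannot express.
    have hind : ∃ y, ∀ c, u (i.insertNth c b) x i = y := by
      by_cases hA : Nonempty A
      · obtain ⟨c₀⟩ := hA
        refine ⟨u (i.insertNth c₀ b) x i, fun c => ?_⟩
        refine congrFun (congrArg DFunLike.coe (trajectory_congr σ π fun j hj => ?_)) x
        have hj' : j < m + 1 := hj.trans i.2
        have := extendSeq_val (i.insertNth c b : Fin (m + 1) → A) ⟨j, hj'⟩
        have h' := extendSeq_val (i.insertNth c₀ b : Fin (m + 1) → A) ⟨j, hj'⟩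
        simp only at this h'
        rw [this, h']
        rw [Fin.insertNth_apply_below (by exact hj), Fin.insertNth_apply_below (by exact hj)]
      · exact ⟨x, fun c => absurd ⟨c⟩ hA⟩
    obtain ⟨y, hy⟩ := hind
    simp only [hy]
    rw [Finset.sum_boole]
    exact_mod_cast hback x y
  have htot : ∑ a, ∑ x, Φ a x < ∑ _a : Fin (m + 1) → A, ∑ _x : V, (1 : ℝ) := by
    have hq : 0 < q := by
      by_contra! h
      have : q = 0 := le_antisymm h (Nat.cast_nonneg _)
      rw [this] at hsum
      have h' : 0 ≤ ∑ v, ∑ c, F v c :=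
        Finset.sum_nonneg fun v _ => Finset.sum_nonneg fun c _ => hF v c
      have hN : 0 ≤ N := Nat.cast_nonneg _
      simp only [zero_mul, zero_add] at hsum
      have : 0 ≤ ((m : ℝ) + 1) * ∑ v, ∑ c, F v c + (m + 1) * N := by positivity
      linarith
    have hR : ∑ _a : Fin (m + 1) → A, ∑ _x : V, (1 : ℝ) = q ^ m * (q * N) := by
      simp only [Finset.sum_const, Finset.card_univ, nsmul_eq_mul, mul_one, Fintype.card_fun,
        Fintype.card_fin]
      push_cast
      ring
    have hL : ∑ a, ∑ x, Φ a x ≤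
        q ^ m * (q * ∑ v, g v + (m + 1) * ∑ v, ∑ c, F v c + (m + 1) * N) := by
      simp only [Φ, Finset.sum_add_distrib]
      rw [h1]
      have e2 : ∑ a : Fin (m + 1) → A, ∑ x, ∑ i : Fin (m + 1), F (u a x i) (a i) =
          ∑ i : Fin (m + 1), ∑ a : Fin (m + 1) → A, ∑ x, F (u a x i) (a i) := by
        refine (Finset.sum_congr rfl fun a _ => Finset.sum_comm).trans ?_
        rw [Finset.sum_comm]
      have e3 : ∑ a : Fin (m + 1) → A, ∑ x, ∑ i : Fin (m + 1),
          (if back x (u a x i) (a i) then (1 : ℝ) else 0) =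
          ∑ i : Fin (m + 1), ∑ a : Fin (m + 1) → A, ∑ x,
            (if back x (u a x i) (a i) then (1 : ℝ) else 0) := by
        refine (Finset.sum_congr rfl fun a _ => Finset.sum_comm).trans ?_
        rw [Finset.sum_comm]
      rw [e2, e3]
      simp only [h2]
      have := Finset.sum_le_sum fun i (_ : i ∈ Finset.univ) => h3 i
      simp only [Finset.sum_const, Finset.card_univ, Fintype.card_fin, nsmul_eq_mul] at this ⊢
      push_cast at this ⊢
      linarith
    rw [hR]
    exact hL.trans_lt (mul_lt_mul_of_pos_left hsum (pow_pos hq m))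
  obtain ⟨a, _, ha⟩ := Finset.exists_lt_of_sum_lt htot
  obtain ⟨x, _, hx⟩ := Finset.exists_lt_of_sum_lt ha
  have hnn : ∀ i ∈ (Finset.univ : Finset (Fin (m + 1))),
      0 ≤ F (u a x i) (a i) + if back x (u a x i) (a i) then (1 : ℝ) else 0 := fun i _ =>
    add_nonneg (hF _ _) (by split_ifs <;> norm_num)
  refine ⟨u a x, extendSeq a, fun i => rfl, ?_, fun i hi hb => ?_⟩
  · refine lt_of_le_of_lt ?_ hx
    rw [Finset.sum_range]
    change g x + _ ≤ g x + _
    gcongr with i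
    rw [extendSeq_val]
    have : (0 : ℝ) ≤ if back x (u a x i) (a i) then (1 : ℝ) else 0 := by split_ifs <;> norm_num
    linarith
  · have h4 := Finset.single_le_sum hnn (Finset.mem_univ (⟨i, by omega⟩ : Fin (m + 1)))
    have h5 : back x (u a x i) (a ⟨i, by omega⟩) := by
      have := extendSeq_val a ⟨i, by omega⟩
      rw [← this]
      exact hb
    simp only [h5, if_true] at h4
    have h6 := hF (u a x i) (a ⟨i, by omega⟩)
    have h7 := hg x
    have h8 : Φ a x < 1 := hx
    simp only [Φ] at h8
    linarith

end Trajectories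

/-! ### Contracted distances with few clusters -/

namespace SimpleGraph

open Classical in
/-- Suppose the vertices of an edge-coloured graph of large girth are grouped into few clusters, and
`Reach u v x` expresses that `v` is at distance at most `x` from `u` after the clusters are
contracted. Then the contracted distance cannot be comparable to the distance in the graph. -/
theorem LocallyTree.not_few_clusters {V K A : Type*} [Fintype V] [Fintype K] [Fintype A]
    [Nonempty V] [Nonempty A] {G : SimpleGraph V} (hc : G.Connected) {h : ℕ} (hG : G.LocallyTree h)
    (π : A → Equiv.Perm V) (hinvol : ∀ a v, π a (π a v) = v)
    (hadj : ∀ a v, π a v ≠ v → G.Adj v (π a v))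
    (hinj : ∀ a a' v, π a v = π a' v → π a v ≠ v → a = a')
    (cl : V → K) (good : V → Prop) (Reach : V → V → ℝ → Prop) (len : V → A → ℝ)
    (hlen : ∀ v a, 0 ≤ len v a) {b Λ : ℝ} {m R B Dn : ℕ} (hb : 0 < b)
    (hreach_cl : ∀ u v, cl u = cl v → Reach u v 0)
    (hreach_trans : ∀ u v w x y, Reach u v x → Reach v w y → Reach u w (x + y))
    (hreach_len : ∀ v a, Reach v (π a v) (len v a))
    (hreach_good : ∀ u v x, good u → good v → Reach u v x → (G.dist u v : ℝ) ≤ x + b)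
    (hΛ : ∑ v, ∑ a, len v a ≤ Λ)
    (hΛb : 4 * ((m + 1) * Λ) ≤ b * (Fintype.card V * Fintype.card A))
    (hngood : 8 * (Finset.univ.filter fun v => ¬ good v).card ≤ Fintype.card V)
    (hB : ∀ u, (Finset.univ.filter fun v => G.dist u v < R).card ≤ B)
    (hKB : 16 * (Fintype.card K * B) ≤ Fintype.card V)
    (hD : ∀ a, (Finset.univ.filter fun v => π a v = v).card ≤ Dn)
    (hDn : 32 * ((m + 1) * Dn) ≤ Fintype.card V)
    (hmA : 64 * (m + 1) ≤ Fintype.card A)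
    (hh : 3 * b + m ≤ h) (hR : 2 * (2 * b + m) ≤ R * (m + 1)) : False := by
  have hN : (0 : ℝ) < Fintype.card V := by exact_mod_cast Fintype.card_pos
  have hq : (0 : ℝ) < Fintype.card A := by exact_mod_cast Fintype.card_pos
  have hRpos : 0 < R := by
    rcases Nat.eq_zero_or_pos R with h0 | h0
    · subst h0
      have : (0 : ℝ) ≤ m := Nat.cast_nonneg m
      simp only [Nat.cast_zero, zero_mul] at hR
      linarith
    · exact h0
  obtain ⟨σ, hσcl, hσgood, hσbad, hσnear⟩ := exists_perm_cluster_fixing_card_near_le cl good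
    (fun u v => G.dist u v < R) (B := B) fun u => by convert hB u
  replace hσnear : (Finset.univ.filter fun u => good u ∧ G.dist u (σ u) < R).card ≤
      Fintype.card K * B := by convert hσnear
  -- The edge of colour `c` at `w` does not lead away from `y`; within radius `h` at most one colour
  -- does this.
  let back : V → V → A → Prop := fun y w c =>
    π c w ≠ w ∧ G.dist y w ≤ h ∧ G.dist y (π c w) ≤ G.dist y w
  have hback : ∀ y w, (Finset.univ.filter (back y w)).card ≤ 1 := by
    intro y w
    rw [Finset.card_le_one]
    intro c hc1 c' hc2
    simp only [Finset.mem_filter, Finset.mem_univ, true_and, back] at hc1 hc2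
    by_contra hne
    have h1 : π c w ≠ π c' w := fun h' => hne (hinj c c' w h' hc1.1)
    have h2 := hG y w (π c w) (π c' w) (hadj c w hc1.1) (hadj c' w hc2.1) h1 hc1.2.1 hc1.2.2
    omega
  -- Penalties whose total along the trajectory must stay below `1`: contracted length above `b`,
  -- short jumps in half of the steps, a fixed point of the matching, and a next jump that turns
  -- back over the edge just used.
  let F : V → A → ℝ := fun v c => len (σ v) c / b +
    ((2 / (m + 1)) * (if G.dist v (σ v) < R then 1 else 0) +
    ((if π c (σ v) = σ v then 1 else 0) +
    (if back (σ (π c (σ v))) (π c (σ v)) c then 1 else 0)))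
  have hi : ∀ (p : Prop) [Decidable p], (0 : ℝ) ≤ if p then 1 else 0 := fun p _ => by split_ifs <;> norm_num
  have hM : (0 : ℝ) < m + 1 := by positivity
  have hF1 : ∀ v c, 0 ≤ len (σ v) c / b := fun v c => div_nonneg (hlen _ _) hb.le
  have hF2 : ∀ v, 0 ≤ (2 / ((m : ℝ) + 1)) * (if G.dist v (σ v) < R then 1 else 0) := fun v =>
    mul_nonneg (by positivity) (hi _)
  have hF : ∀ v c, 0 ≤ F v c := fun v c =>
    add_nonneg (hF1 v c) (add_nonneg (hF2 v) (add_nonneg (hi _) (hi _)))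
  have hshort : 16 * (Finset.univ.filter fun v => G.dist v (σ v) < R).card ≤
      3 * Fintype.card V := by
    have hsub : (Finset.univ.filter fun v => G.dist v (σ v) < R) ⊆
        (Finset.univ.filter fun v => ¬ good v) ∪
        (Finset.univ.filter fun v => good v ∧ G.dist v (σ v) < R) := by
      intro v hv
      simp only [Finset.mem_filter, Finset.mem_univ, true_and, Finset.mem_union] at hv ⊢
      tauto
    have := (Finset.card_le_card hsub).trans (Finset.card_union_le _ _)
    omega
  have hS1 : ∑ v, ∑ c, len (σ v) c / b ≤ Λ / b := by
    rw [Equiv.sum_comp σ fun v => ∑ c, len v c / b]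
    simp only [← Finset.sum_div]
    gcongr
  have hS2 : ∑ v, ∑ _c : A, (2 / ((m : ℝ) + 1)) * (if G.dist v (σ v) < R then (1 : ℝ) else 0) =
      Fintype.card A * ((2 / ((m : ℝ) + 1)) *
        (Finset.univ.filter fun v => G.dist v (σ v) < R).card) := by
    simp only [Finset.sum_const, Finset.card_univ, nsmul_eq_mul]
    rw [← Finset.mul_sum, ← Finset.mul_sum, Finset.sum_boole]
  have hS3 : ∑ v, ∑ c, (if π c (σ v) = σ v then (1 : ℝ) else 0) ≤ Fintype.card A * Dn := by
    rw [Equiv.sum_comp σ fun v => ∑ c, (if π c v = v then (1 : ℝ) else 0), Finset.sum_comm,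
      ← nsmul_eq_mul, ← Finset.card_univ, ← Finset.sum_const]
    refine Finset.sum_le_sum fun c _ => ?_
    rw [Finset.sum_boole]
    exact_mod_cast hD c
  have hS4 : ∑ v, ∑ c, (if back (σ (π c (σ v))) (π c (σ v)) c then (1 : ℝ) else 0) ≤
      Fintype.card V := by
    rw [Finset.sum_comm]
    have : ∀ c, ∑ v, (if back (σ (π c (σ v))) (π c (σ v)) c then (1 : ℝ) else 0) =
        ∑ x, if back (σ x) x c then (1 : ℝ) else 0 := fun c =>
      Equiv.sum_comp (π c * σ) fun x => if back (σ x) x c then (1 : ℝ) else 0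
    simp only [this]
    rw [Finset.sum_comm]
    have h1 : (Fintype.card V : ℝ) = ∑ _x : V, (1 : ℝ) := by simp
    rw [h1]
    refine Finset.sum_le_sum fun x _ => ?_
    rw [Finset.sum_boole]
    exact_mod_cast hback (σ x) x
  have hsum : Fintype.card A * ∑ v, (if good v then (0 : ℝ) else 1) +
      (m + 1) * ∑ v, ∑ c, F v c + (m + 1) * Fintype.card V <
      Fintype.card A * Fintype.card V := by
    have e1 : ∑ v, (if good v then (0 : ℝ) else 1) =
        (Finset.univ.filter fun v => ¬ good v).card := by
      rw [← Finset.sum_boole]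
      exact Finset.sum_congr rfl fun v _ => by by_cases hv : good v <;> simp [hv]
    have e2 : ∑ v, ∑ c, F v c ≤ Λ / b + (Fintype.card A * ((2 / ((m : ℝ) + 1)) *
        (Finset.univ.filter fun v => G.dist v (σ v) < R).card) +
        (Fintype.card A * Dn + Fintype.card V)) := by
      simp only [F, Finset.sum_add_distrib]
      rw [hS2]
      gcongr
    -- Relative to `|A| * |V|` the budget is: bad start `1/8`, length `1/4`, short jumps `2 * 3/16`,
    -- fixed points `1/32`, and the two kinds of turning back `1/64` each; the sum is below `1`.
    have a1 : (Fintype.card A : ℝ) * (8 * (Finset.univ.filter fun v => ¬ good v).card) ≤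
        Fintype.card A * Fintype.card V := by
      gcongr
      exact_mod_cast hngood
    have a2 : 4 * (((m : ℝ) + 1) * (Λ / b)) ≤ Fintype.card A * Fintype.card V := by
      rw [← mul_div_assoc, ← mul_div_assoc, div_le_iff₀ hb]
      linarith
    have a3 : ((m : ℝ) + 1) * (Fintype.card A * ((2 / ((m : ℝ) + 1)) *
        (Finset.univ.filter fun v => G.dist v (σ v) < R).card)) =
        Fintype.card A * (2 * (Finset.univ.filter fun v => G.dist v (σ v) < R).card) := by
      field_simp
    have a4 : (Fintype.card A : ℝ) *
        (16 * (Finset.univ.filter fun v => G.dist v (σ v) < R).card) ≤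
        Fintype.card A * (3 * Fintype.card V) :=
      mul_le_mul_of_nonneg_left (by exact_mod_cast hshort) hq.le
    have a5 : (Fintype.card A : ℝ) * (32 * ((m + 1) * Dn)) ≤ Fintype.card A * Fintype.card V := by
      gcongr
      exact_mod_cast hDn
    have a6 : (64 * ((m : ℝ) + 1)) * Fintype.card V ≤ Fintype.card A * Fintype.card V := by
      gcongr
      exact_mod_cast hmA
    have a7 := mul_le_mul_of_nonneg_left e2 hM.le
    have a8 : 0 < (Fintype.card A : ℝ) * Fintype.card V := mul_pos hq hN
    rw [e1]
    rw [mul_add, mul_add, mul_add, a3] at a7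
    linarith
  obtain ⟨u, c, hu, hlt, hnb⟩ := exists_trajectory σ π m (fun v => if good v then (0 : ℝ) else 1)
    (fun v => by split_ifs <;> norm_num) F hF (fun x v c => back x (σ v) c)
    (fun x v => by convert hback x (σ v)) hsum
  have hg0 : good (u 0) := by
    by_contra hng
    simp only [hng, if_false] at hlt
    have := Finset.sum_nonneg fun i (_ : i ∈ Finset.range (m + 1)) => hF (u i) (c i)
    linarith
  simp only [hg0, if_true, zero_add] at hlt
  have hsingle : ∀ i ≤ m, F (u i) (c i) < 1 := fun i hi' =>
    (Finset.single_le_sum (f := fun i => F (u i) (c i)) (fun i _ => hF _ _)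
      (Finset.mem_range.2 (by omega : i < m + 1))).trans_lt hlt
  have hmove : ∀ i ≤ m, π (c i) (σ (u i)) ≠ σ (u i) := by
    intro i hi' he
    have h1 := hsingle i hi'
    simp only [F, he, if_true] at h1
    have h2 := hF1 (u i) (c i)
    have h3 := hF2 (u i)
    have h4 := hi (back (σ (σ (u i))) (σ (u i)) (c i))
    linarith
  have hnb' : ∀ i ≤ m, ¬ back (σ (u (i + 1))) (u (i + 1)) (c i) := by
    intro i hi' he
    rw [hu] at he
    have h1 := hsingle i hi'
    simp only [F, he, if_true] at h1
    have h2 := hF1 (u i) (c i)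
    have h3 := hF2 (u i)
    have h4 := hi (π (c i) (σ (u i)) = σ (u i))
    linarith
  have hlensum : ∀ i ≤ m + 1, ∑ j ∈ Finset.range i, len (σ (u j)) (c j) ≤ b := by
    intro i hi'
    have h1 : ∑ j ∈ Finset.range (m + 1), len (σ (u j)) (c j) / b < 1 := by
      refine lt_of_le_of_lt (Finset.sum_le_sum fun j _ => ?_) hlt
      exact le_add_of_nonneg_right (add_nonneg (hF2 _) (add_nonneg (hi _) (hi _)))
    rw [← Finset.sum_div, div_lt_one hb] at h1
    refine le_trans (Finset.sum_le_sum_of_subset_of_nonneg ?_ fun _ _ _ => hlen _ _) h1.le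
    exact Finset.range_subset_range.2 hi'
  have hcount : 2 * ((Finset.range (m + 1)).filter fun i => G.dist (u i) (σ (u i)) < R).card <
      m + 1 := by
    have h1 : ∑ j ∈ Finset.range (m + 1),
        (2 / ((m : ℝ) + 1)) * (if G.dist (u j) (σ (u j)) < R then (1 : ℝ) else 0) < 1 := by
      refine lt_of_le_of_lt (Finset.sum_le_sum fun j _ => ?_) hlt
      have h2 := hF1 (u j) (c j)
      have h3 := hi (π (c j) (σ (u j)) = σ (u j))
      have h4 := hi (back (σ (π (c j) (σ (u j)))) (π (c j) (σ (u j))) (c j))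
      simp only [F]
      linarith
    rw [← Finset.mul_sum, Finset.sum_boole, div_mul_eq_mul_div, div_lt_one hM] at h1
    exact_mod_cast h1
  have hreach : ∀ i, Reach (u 0) (σ (u i)) (∑ j ∈ Finset.range i, len (σ (u j)) (c j)) := by
    intro i
    induction i with
    | zero => simpa using hreach_cl _ _ (hσcl (u 0)).symm
    | succ i ih =>
      rw [Finset.sum_range_succ]
      have h1 := hreach_trans _ _ _ _ _ ih (hreach_len (σ (u i)) (c i))
      have h2 := hreach_trans _ _ _ _ _ h1 (hreach_cl _ (σ (u (i + 1))) (by rw [hσcl, hu]))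
      rwa [add_zero] at h2
  have hjump : ∀ i, (G.dist (u i) (σ (u i)) : ℝ) ≤ b := by
    intro i
    by_cases hg : good (u i)
    · have := hreach_good _ _ 0 hg (hσgood _ hg) (hreach_cl _ _ (hσcl (u i)).symm)
      linarith
    · rw [hσbad _ hg]
      simpa using hb.le
  -- At good positions the contracted length, at most `b`, bounds the distance by `2 * b`. At bad
  -- ones `σ` does not move, so only one matching edge is added.
  have hdle : ∀ i ≤ m, (G.dist (u 0) (σ (u i)) : ℝ) ≤ 2 * b + i := by
    intro i hi'
    induction i with
    | zero =>
      have := hjump 0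
      simp only [Nat.cast_zero, add_zero]
      linarith
    | succ i ih =>
      by_cases hg : good (u (i + 1))
      · have h1 := hreach_good _ _ _ hg0 (hσgood _ hg) (hreach (i + 1))
        have h2 := hlensum (i + 1) (by omega)
        push_cast
        have : (0 : ℝ) ≤ i := Nat.cast_nonneg i
        linarith
      · rw [hσbad _ hg, hu]
        have h1 := hc.dist_triangle (u := u 0) (v := σ (u i)) (w := π (c i) (σ (u i)))
        rw [dist_eq_one_iff_adj.2 (hadj _ _ (hmove i (by omega)))] at h1
        have h2 := ih (by omega)
        have h3 : (G.dist (u 0) (π (c i) (σ (u i))) : ℝ) ≤ G.dist (u 0) (σ (u i)) + 1 := by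
          exact_mod_cast h1
        push_cast
        linarith
  -- Neither the matching edge nor the following jump turns back, so `dist_add` applies; all
  -- distances stay within its range because `3 * b + m ≤ h`.
  have hgrow : ∀ i ≤ m, ∑ j ∈ Finset.range (i + 1), G.dist (u j) (σ (u j)) ≤
      G.dist (u 0) (σ (u i)) := by
    intro i hi'
    induction i with
    | zero => simp
    | succ i ih =>
      rw [Finset.sum_range_succ]
      have hd := hdle i (by omega)
      have hj := hjump (i + 1)
      have him : (i : ℝ) + 1 ≤ m := by exact_mod_cast hi'
      have hadj' : G.Adj (σ (u i)) (u (i + 1)) := by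
        rw [hu]; exact hadj _ _ (hmove i (by omega))
      have hdh : G.dist (u 0) (σ (u i)) ≤ h := by
        have : (G.dist (u 0) (σ (u i)) : ℝ) ≤ h := by linarith
        exact_mod_cast this
      have hjh : G.dist (σ (u (i + 1))) (u (i + 1)) ≤ h := by
        rw [dist_comm]
        have : (G.dist (u (i + 1)) (σ (u (i + 1))) : ℝ) ≤ h := by
          have : (0 : ℝ) ≤ i := Nat.cast_nonneg i
          linarith
        exact_mod_cast this
      have h1 : G.dist (u 0) (σ (u i)) < G.dist (u 0) (u (i + 1)) := by
        by_contra! hle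
        refine hnb i (by omega) ⟨hmove i (by omega), hdh, ?_⟩
        rwa [← hu]
      have h2 : G.dist (σ (u (i + 1))) (u (i + 1)) < G.dist (σ (u (i + 1))) (σ (u i)) := by
        by_contra! hle
        have he : π (c i) (u (i + 1)) = σ (u i) := by rw [hu, hinvol]
        refine hnb' i (by omega) ⟨?_, hjh, ?_⟩
        · rw [he]; exact hadj'.ne
        · rwa [he]
      have h3 : G.dist (u 0) (u (i + 1)) ≤ G.dist (u 0) (σ (u i)) + 1 := by
        have := hc.dist_triangle (u := u 0) (v := σ (u i)) (w := u (i + 1))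
        rwa [dist_eq_one_iff_adj.2 hadj'] at this
      have h4 : G.dist (u 0) (u (i + 1)) + G.dist (σ (u (i + 1))) (u (i + 1)) ≤ h + 1 := by
        rw [dist_comm (u := σ (u (i + 1)))]
        have h3' : (G.dist (u 0) (u (i + 1)) : ℝ) ≤ G.dist (u 0) (σ (u i)) + 1 := by
          exact_mod_cast h3
        have : (G.dist (u 0) (u (i + 1)) : ℝ) + G.dist (u (i + 1)) (σ (u (i + 1))) ≤ h + 1 := by
          linarith
        exact_mod_cast this
      have h5 := hG.dist_add hc hadj' h1 h2 h4
      have h6 := ih (by omega)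
      rw [dist_comm (u := u (i + 1))]
      omega
  -- More than half of the `m + 1` jumps have length at least `R`, which contradicts `hdle` at time
  -- `m`.
  have htot : R * ((Finset.range (m + 1)).filter fun i => ¬ G.dist (u i) (σ (u i)) < R).card ≤
      G.dist (u 0) (σ (u m)) := by
    refine le_trans ?_ (hgrow m le_rfl)
    rw [mul_comm, ← smul_eq_mul, ← Finset.sum_const]
    refine le_trans (Finset.sum_le_sum fun i hi' => ?_)
      (Finset.sum_le_sum_of_subset (Finset.filter_subset _ _))
    simpa using (Finset.mem_filter.1 hi').2
  have hcompl := Finset.card_filter_add_card_filter_not (s := Finset.range (m + 1))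
    (fun i => G.dist (u i) (σ (u i)) < R)
  rw [Finset.card_range] at hcompl
  have hlarge : m + 1 <
      2 * ((Finset.range (m + 1)).filter fun i => ¬ G.dist (u i) (σ (u i)) < R).card := by omega
  have h1 := Nat.mul_lt_mul_of_pos_left hlarge hRpos
  have h2 : R * (m + 1) < 2 * G.dist (u 0) (σ (u m)) := by
    calc _ < _ := h1
      _ = 2 * (R * ((Finset.range (m + 1)).filter
          fun i => ¬ G.dist (u i) (σ (u i)) < R).card) := by ring
      _ ≤ _ := by gcongr
  have h3 : (R : ℝ) * (m + 1) < 2 * G.dist (u 0) (σ (u m)) := by exact_mod_cast h2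
  have h4 := hdle m le_rfl
  linarith

end SimpleGraph

/-! ### Lengths pulled back from the contraction -/

section Contraction

variable {V : Type*} [Fintype V] [DecidableEq V]

/-- The edge lengths of a graph that are induced by edge lengths of a contraction. -/
def pullLength (F : Finpartition (Finset.univ : Finset V)) (ℓ : Sym2 F.parts → ℝ)
    (e : Sym2 V) : ℝ :=
  open Classical in if (e.map (clusterOf F)).IsDiag then 0 else ℓ (e.map (clusterOf F))

theorem pullLength_nonneg {F : Finpartition (Finset.univ : Finset V)} {ℓ : Sym2 F.parts → ℝ}
    (hℓ : ∀ e, 0 ≤ ℓ e) (e : Sym2 V) : 0 ≤ pullLength F ℓ e := by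
  rw [pullLength]
  split_ifs
  · exact le_rfl
  · exact hℓ _

theorem CapGraph.contract_adj (G : CapGraph V) (F : Finpartition (Finset.univ : Finset V))
    {u v : V} (h : G.graph.Adj u v) (hne : clusterOf F u ≠ clusterOf F v) :
    (G.contract F).graph.Adj (clusterOf F u) (clusterOf F v) :=
  ⟨hne, u, v, rfl, rfl, h⟩

/-- Edges inside a cluster have pulled-back length zero and are dropped; the others map to edges of
the contraction. -/
theorem CapGraph.exists_contract_walk (G : CapGraph V)
    (F : Finpartition (Finset.univ : Finset V)) (ℓ : Sym2 F.parts → ℝ)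
    {u v : V} (p : G.graph.Walk u v) :
    ∃ q : (G.contract F).graph.Walk (clusterOf F u) (clusterOf F v),
      (q.edges.map ℓ).sum = (p.edges.map (pullLength F ℓ)).sum := by
  induction p with
  | nil => exact ⟨.nil, by simp⟩
  | @cons u w v h p ih =>
    obtain ⟨q, hq⟩ := ih
    by_cases he : clusterOf F u = clusterOf F w
    · exact ⟨q.copy he.symm rfl, by simp [hq, pullLength, he]⟩
    · exact ⟨.cons (G.contract_adj F h he) q, by simp [hq, pullLength, he]⟩

-- Volume is preserved by the pullback: parallel edges between two clusters share one length, and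
-- their capacities add up.
open Classical in
theorem CapGraph.sum_contract_cap (G : CapGraph V) (F : Finpartition (Finset.univ : Finset V))
    (ℓ : Sym2 F.parts → ℝ) :
    ∑ e ∈ (G.contract F).graph.edgeFinset, ((G.contract F).cap e : ℝ) * ℓ e =
      ∑ e ∈ G.graph.edgeFinset, (G.cap e : ℝ) * pullLength F ℓ e := by
  have h1 : ∑ e ∈ G.graph.edgeFinset, (G.cap e : ℝ) * pullLength F ℓ e =
      ∑ e ∈ G.graph.edgeFinset.filter (fun e => ¬ (e.map (clusterOf F)).IsDiag),
        (G.cap e : ℝ) * ℓ (e.map (clusterOf F)) := by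
    rw [Finset.sum_filter]
    refine Finset.sum_congr rfl fun e _ => ?_
    by_cases he : (e.map (clusterOf F)).IsDiag <;> simp [pullLength, he]
  have hmaps : ∀ e ∈ G.graph.edgeFinset.filter (fun e => ¬ (e.map (clusterOf F)).IsDiag),
      e.map (clusterOf F) ∈ (G.contract F).graph.edgeFinset := by
    intro e he
    rw [Finset.mem_filter, SimpleGraph.mem_edgeFinset] at he
    rw [SimpleGraph.mem_edgeFinset]
    induction e with
    | _ u v => exact G.contract_adj F he.1 he.2
  rw [h1, ← Finset.sum_fiberwise_of_maps_to hmaps]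
  refine Finset.sum_congr rfl fun e' he' => ?_
  have hcap : (G.contract F).cap e' =
      ∑ e ∈ G.graph.edgeFinset.filter (fun e => e.map (clusterOf F) = e'), G.cap e := rfl
  rw [SimpleGraph.mem_edgeFinset] at he'
  have hnd := (G.contract F).graph.not_isDiag_of_mem_edgeSet he'
  rw [hcap]
  push_cast
  rw [Finset.sum_mul, Finset.filter_filter]
  refine Finset.sum_congr ?_ fun e he => ?_
  · ext e
    simp only [Finset.mem_filter]
    refine and_congr_right fun _ => ⟨fun h => ⟨h ▸ hnd, h⟩, fun h => h.2⟩
  · rw [Finset.mem_filter] at he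
    rw [he.2.2]

end Contraction

/-! ### Reinforced capacities -/

section Reinforcement

variable {V : Type*} [Fintype V] [DecidableEq V]

/-- The graph in which the capacity of an edge grows with the number of sets `E u` that contain
it. -/
def reinforcedGraph (Γ : SimpleGraph V) (S : Finset V) (E : V → Finset (Sym2 V)) (w : ℝ≥0) :
    CapGraph V where
  graph := Γ
  cap e := 1 + w * (S.filter fun u => e ∈ E u).card
  one_le_cap _ _ := le_self_add

-- Double counting. It makes one volume bound control both the total edge length and the total
-- length of the chosen sets.
open Classical in
theorem sum_cap_reinforcedGraph (Γ : SimpleGraph V) (S : Finset V) (E : V → Finset (Sym2 V))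
    (w : ℝ≥0) (hE : ∀ u ∈ S, E u ⊆ Γ.edgeFinset) (ℓ : Sym2 V → ℝ) :
    ∑ e ∈ Γ.edgeFinset, ((reinforcedGraph Γ S E w).cap e : ℝ) * ℓ e =
      ∑ e ∈ Γ.edgeFinset, ℓ e + w * ∑ u ∈ S, ∑ e ∈ E u, ℓ e := by
  have h1 : ∀ u ∈ S, ∑ e ∈ E u, ℓ e = ∑ e ∈ Γ.edgeFinset, if e ∈ E u then ℓ e else 0 := by
    intro u hu
    rw [← Finset.sum_filter]
    congr 1
    ext e
    simp only [Finset.mem_filter]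
    exact ⟨fun h => ⟨hE u hu h, h⟩, fun h => h.2⟩
  rw [Finset.sum_congr rfl h1, Finset.sum_comm, Finset.mul_sum, ← Finset.sum_add_distrib]
  refine Finset.sum_congr rfl fun e _ => ?_
  rw [← Finset.sum_filter, Finset.sum_const, nsmul_eq_mul]
  simp only [reinforcedGraph]
  push_cast
  ring

end Reinforcement

/-! ### Counting edges and colours -/

namespace SimpleGraph

variable {V : Type*} [Fintype V]

open Classical in
theorem two_mul_card_edgeFinset_le (Γ : SimpleGraph V) {K : ℕ}
    (hK : ∀ v, (Finset.univ.filter (Γ.Adj v)).card ≤ K) :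
    2 * Γ.edgeFinset.card ≤ Fintype.card V * K := by
  rw [← Γ.sum_degrees_eq_twice_card_edges, ← smul_eq_mul, ← Finset.card_univ, ← Finset.sum_const]
  refine Finset.sum_le_sum fun v _ => ?_
  rw [← card_neighborFinset_eq_degree, neighborFinset_eq_filter]
  exact hK v

open Classical in
/-- Each edge is used by at most two pairs of a vertex and a colour. -/
theorem sum_colours_le {A : Type*} [Fintype A] (Γ : SimpleGraph V) (π : A → Equiv.Perm V)
    (hadj : ∀ a v, π a v ≠ v → Γ.Adj v (π a v))
    (hinj : ∀ a a' v, π a v = π a' v → π a v ≠ v → a = a')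
    (ℓ : Sym2 V → ℝ) (hℓ : ∀ e, 0 ≤ ℓ e) :
    ∑ v, ∑ a, (if π a v = v then 0 else ℓ s(v, π a v)) ≤ 2 * ∑ e ∈ Γ.edgeFinset, ℓ e := by
  have h1 : ∑ v, ∑ a, (if π a v = v then 0 else ℓ s(v, π a v)) =
      ∑ x ∈ (Finset.univ : Finset (V × A)).filter (fun x => π x.2 x.1 ≠ x.1),
        ℓ s(x.1, π x.2 x.1) := by
    rw [Finset.sum_filter, Fintype.sum_prod_type]
    refine Finset.sum_congr rfl fun v _ => Finset.sum_congr rfl fun a _ => ?_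
    by_cases h : π a v = v <;> simp [h]
  have hmaps : ∀ x ∈ (Finset.univ : Finset (V × A)).filter (fun x => π x.2 x.1 ≠ x.1),
      s(x.1, π x.2 x.1) ∈ Γ.edgeFinset := by
    intro x hx
    rw [Finset.mem_filter] at hx
    rw [mem_edgeFinset]
    exact hadj _ _ hx.2
  rw [h1, ← Finset.sum_fiberwise_of_maps_to hmaps, Finset.mul_sum]
  refine Finset.sum_le_sum fun e he => ?_
  have h2 : ∀ x ∈ ((Finset.univ : Finset (V × A)).filter (fun x => π x.2 x.1 ≠ x.1)).filter
      (fun x => s(x.1, π x.2 x.1) = e), ℓ s(x.1, π x.2 x.1) = ℓ e := by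
    intro x hx
    rw [(Finset.mem_filter.1 hx).2]
  rw [Finset.sum_congr rfl h2, Finset.sum_const, nsmul_eq_mul]
  refine mul_le_mul_of_nonneg_right ?_ (hℓ e)
  -- The edge and its starting vertex determine the colour, because the matchings are disjoint.
  have h3 : (((Finset.univ : Finset (V × A)).filter (fun x => π x.2 x.1 ≠ x.1)).filter
      (fun x => s(x.1, π x.2 x.1) = e)).card ≤ e.toFinset.card := by
    refine Finset.card_le_card_of_injOn Prod.fst ?_ ?_
    · rintro ⟨v, a⟩ hx
      simp only [Finset.coe_filter, Finset.mem_filter, Finset.mem_univ, true_and,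
        Set.mem_ofPred_eq] at hx
      simp [← hx.2]
    · rintro ⟨v, a⟩ hx ⟨v', a'⟩ hx' hv
      simp only [Finset.coe_filter, Finset.mem_filter, Finset.mem_univ, true_and,
        Set.mem_ofPred_eq] at hx hx' hv
      subst hv
      have h4 := hx.2.trans hx'.2.symm
      rw [Sym2.congr_right] at h4
      rw [hinj a a' v h4 hx.1]
  have h4 : e.toFinset.card ≤ 2 := by
    rw [Sym2.card_toFinset]
    split_ifs <;> omega
  exact_mod_cast h3.trans h4

end SimpleGraph

/-! ### From short contracted distances to a hard demand -/

open Classical in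
/-- If a partition has few clusters, then contracting its clusters makes some demand easy that is
hard in the graph itself. -/
theorem exists_demand_of_contract {V : Type*} [Fintype V] [DecidableEq V] [Nonempty V]
    {Γ : SimpleGraph V} (hc : Γ.Connected) {Δ h r R B Dn : ℕ} (hΓ : Γ.LocallyTree h)
    (π : Fin Δ → Equiv.Perm V) (hinvol : ∀ a v, π a (π a v) = v)
    (hadj : ∀ a v, π a v ≠ v → Γ.Adj v (π a v))
    (hinj : ∀ a a' v, π a v = π a' v → π a v ≠ v → a = a')
    (hdeg : ∀ v, (Finset.univ.filter (Γ.Adj v)).card ≤ Δ + 2)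
    (hfix : ∀ a, (Finset.univ.filter fun v => π a v = v).card ≤ Dn)
    (S T : Finset V) (τ : V → V) (hτ : ∀ u ∈ S, τ u ∈ T) (p : ∀ u, Γ.Walk u (τ u))
    (hp : ∀ u, (p u).IsPath) (hpr : ∀ u ∈ S, (p u).length ≤ r) {x : ℝ} (hx : 1 ≤ x) (hr : 1 ≤ r)
    (hrΔ : 256 * r ≤ Δ) (hxh : 192 * (x * r) + 10 * r ≤ h) (hxR : 64 * x + 4 ≤ R)
    (hB : ∀ u, (Finset.univ.filter fun v => Γ.dist u v < R).card ≤ B)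
    (hS : 16 * (Finset.univ.filter fun v => v ∉ S).card ≤ Fintype.card V)
    (hDn : 128 * (r * Dn) ≤ Fintype.card V)
    (F : Finpartition (Finset.univ : Finset V)) (hF : 16 * (F.parts.card * B) ≤ Fintype.card V) :
    let G := reinforcedGraph Γ S (fun u => (p u).edges.toFinset) (Δ / r : ℝ≥0)
    ∃ D : Demand T, ENNReal.ofReal x ≤ G.cong (fun t : T => (t : V)) D ∧
      (G.contract F).cong (fun t : T => clusterOf F (t : V)) D ≤ 3 := by
  intro G
  obtain ⟨N, hN⟩ : ∃ N : ℝ, N = Fintype.card V := ⟨_, rfl⟩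
  have hN0 : 0 < N := by rw [hN]; exact_mod_cast Fintype.card_pos
  have hr' : (1 : ℝ) ≤ r := by exact_mod_cast hr
  have hΔr : 256 * (r : ℝ) ≤ Δ := by exact_mod_cast hrΔ
  have hΔ0 : (0 : ℝ) < Δ := by linarith
  have hE : ∀ u ∈ S, (p u).edges.toFinset ⊆ Γ.edgeFinset := by
    intro u _ e he
    rw [SimpleGraph.mem_edgeFinset]
    exact (p u).edges_subset_edgeSet (by simpa using he)
  have hsumE : ∀ (ℓ : Sym2 V → ℝ) u, ∑ e ∈ (p u).edges.toFinset, ℓ e = ((p u).edges.map ℓ).sum :=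
    fun ℓ u => List.sum_toFinset _ (hp u).isTrail.edges_nodup
  have hcap : ∑ e ∈ G.graph.edgeFinset, (G.cap e : ℝ) ≤ 3 * (N * Δ) := by
    have h1 := sum_cap_reinforcedGraph Γ S (fun u => (p u).edges.toFinset) (Δ / r : ℝ≥0) hE
      fun _ => 1
    simp only [mul_one] at h1
    have h2 : 2 * (Γ.edgeFinset.card : ℝ) ≤ N * (Δ + 2) := by
      rw [hN]; exact_mod_cast Γ.two_mul_card_edgeFinset_le hdeg
    have h3 : ∑ u ∈ S, ∑ _e ∈ (p u).edges.toFinset, (1 : ℝ) ≤ N * r := by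
      calc _ ≤ ∑ _u ∈ S, (r : ℝ) := by
            refine Finset.sum_le_sum fun u hu => ?_
            rw [Finset.sum_const, nsmul_eq_mul, mul_one,
              List.toFinset_card_of_nodup (hp u).isTrail.edges_nodup, (p u).length_edges]
            exact_mod_cast hpr u hu
        _ ≤ N * r := by
            rw [Finset.sum_const, nsmul_eq_mul, hN]
            gcongr
            exact Finset.card_le_univ S
    have h4 : ((Δ / r : ℝ≥0) : ℝ) * ∑ u ∈ S, ∑ _e ∈ (p u).edges.toFinset, (1 : ℝ) ≤ N * Δ := by
      push_cast
      rw [div_mul_eq_mul_div, div_le_iff₀ (by linarith)]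
      nlinarith
    have h5 : ∑ e ∈ G.graph.edgeFinset, (G.cap e : ℝ) = ∑ e ∈ Γ.edgeFinset, (1 : ℝ) +
      ((Δ / r : ℝ≥0) : ℝ) * ∑ u ∈ S, ∑ _e ∈ (p u).edges.toFinset, (1 : ℝ) := h1
    rw [h5, Finset.sum_const, nsmul_eq_mul, mul_one]
    nlinarith
  have hx0 : 0 < x := by linarith
  -- The threshold `6 * (x * (N * Δ))` is `2 * x` times the bound on the total capacity.
  rcases CapGraph.exists_demand_or_exists_length (G.contract F)
    (fun t : T => clusterOf F (t : V)) (fun t t' => (Γ.dist (t : V) t' : ℝ))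
    (V := 6 * (x * (N * Δ))) (by positivity) (fun _ _ => Nat.cast_nonneg _) (fun _ => by simp)
    with ⟨D, hD3, hD⟩ | ⟨ℓ, hℓ, hvol, hdist⟩
  · refine ⟨D, G.le_cong_of_sum_dist Subtype.val_injective D (lt_of_le_of_lt ?_ hD), hD3⟩
    calc _ ≤ 2 * x * (3 * (N * Δ)) := by gcongr
      _ = _ := by ring
  exfalso
  rw [CapGraph.sum_contract_cap] at hvol
  have hvol' : ∑ e ∈ Γ.edgeFinset, pullLength F ℓ e +
      ((Δ / r : ℝ≥0) : ℝ) * ∑ u ∈ S, ∑ e ∈ (p u).edges.toFinset, pullLength F ℓ e ≤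
      2 * (x * (N * Δ)) := by
    rw [← sum_cap_reinforcedGraph Γ S (fun u => (p u).edges.toFinset) (Δ / r : ℝ≥0) hE]
    change 3 * ∑ e ∈ Γ.edgeFinset, ((reinforcedGraph Γ S (fun u => (p u).edges.toFinset)
      (Δ / r : ℝ≥0)).cap e : ℝ) * pullLength F ℓ e ≤ _ at hvol
    linarith
  have hpull := pullLength_nonneg (F := F) hℓ
  have hvol1 : 0 ≤ ∑ e ∈ Γ.edgeFinset, pullLength F ℓ e := Finset.sum_nonneg fun e _ => hpull e
  have hvol2 : 0 ≤ ∑ u ∈ S, ∑ e ∈ (p u).edges.toFinset, pullLength F ℓ e :=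
    Finset.sum_nonneg fun u _ => Finset.sum_nonneg fun e _ => hpull e
  let cost : V → ℝ := fun u => ((p u).edges.map (pullLength F ℓ)).sum
  have hcost : ∀ u, 0 ≤ cost u := fun u => by
    simp only [cost]
    rw [← hsumE]
    exact Finset.sum_nonneg fun e _ => hpull e
  have hcosts : ∑ u ∈ S, cost u ≤ 2 * (x * (N * r)) := by
    have h1 : ((Δ / r : ℝ≥0) : ℝ) * ∑ u ∈ S, ∑ e ∈ (p u).edges.toFinset, pullLength F ℓ e ≤
      2 * (x * (N * Δ)) := by linarith
    push_cast at h1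
    rw [div_mul_eq_mul_div, div_le_iff₀ (by linarith)] at h1
    simp only [hsumE] at h1
    refine le_of_mul_le_mul_left ?_ hΔ0
    calc _ ≤ _ := h1
      _ = _ := by ring
  -- Sixteen times the bound on the average cost, so by Markov at most `N / 16` vertices of `S` are
  -- lost.
  let good : V → Prop := fun u => u ∈ S ∧ cost u ≤ 32 * (x * r)
  have hexp : (S.filter fun u => ¬ cost u ≤ 32 * (x * r)).card * (16 : ℝ) ≤ N := by
    have h1 : (S.filter fun u => ¬ cost u ≤ 32 * (x * r)).card * (32 * (x * r)) ≤
        ∑ u ∈ S, cost u := by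
      rw [← nsmul_eq_mul, ← Finset.sum_const]
      refine le_trans (Finset.sum_le_sum fun u hu => ?_)
        (Finset.sum_le_sum_of_subset_of_nonneg (Finset.filter_subset _ _) fun u _ _ => hcost u)
      exact (not_le.1 (Finset.mem_filter.1 hu).2).le
    have h2 : (0 : ℝ) < 2 * (x * r) := by positivity
    refine le_of_mul_le_mul_right ?_ h2
    linarith
  have hngood : 8 * (Finset.univ.filter fun v => ¬ good v).card ≤ Fintype.card V := by
    have hsub : (Finset.univ.filter fun v => ¬ good v) ⊆
        (Finset.univ.filter fun v => v ∉ S) ∪ S.filter fun u => ¬ cost u ≤ 32 * (x * r) := by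
      intro v hv
      simp only [good, Finset.mem_filter, Finset.mem_univ, true_and, Finset.mem_union] at hv ⊢
      tauto
    have h1 := (Finset.card_le_card hsub).trans (Finset.card_union_le _ _)
    have h2 : (S.filter fun u => ¬ cost u ≤ 32 * (x * r)).card * 16 ≤ Fintype.card V := by
      rw [hN] at hexp
      exact_mod_cast hexp
    omega
  have hwalk : ∀ {u v : V} (p : Γ.Walk u v),
      ∃ q : (G.contract F).graph.Walk (clusterOf F u) (clusterOf F v),
        (q.edges.map ℓ).sum = (p.edges.map (pullLength F ℓ)).sum :=
    fun p => G.exists_contract_walk F ℓ p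
  have : Nonempty (Fin Δ) := ⟨⟨0, by omega⟩⟩
  -- `b` allows for two costs of `32 * (x * r)` and two paths of `r` edges. A random coloured edge
  -- has average length at most `4 * x`, so `m + 1 = 4 * r` steps cost `16 * (x * r)` on average, at
  -- most `b / 4`.
  refine hΓ.not_few_clusters hc π hinvol hadj hinj (clusterOf F) good
    (fun u v y => ∃ q : (G.contract F).graph.Walk (clusterOf F u) (clusterOf F v),
      (q.edges.map ℓ).sum ≤ y)
    (fun v a => if π a v = v then 0 else pullLength F ℓ s(v, π a v))
    (fun v a => by split_ifs <;> simp [hpull])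
    (b := 64 * (x * r) + 2 * r) (Λ := 4 * (x * (N * Δ))) (m := 4 * r - 1) (R := R) (B := B)
    (Dn := Dn) (by positivity) ?_ ?_ ?_ ?_ ?_ ?_ (by convert hngood) hB ?_ (fun a => by convert hfix a) ?_ ?_ ?_ ?_
  · intro u v h
    rw [h]
    exact ⟨.nil, by simp⟩
  · rintro u v w y z ⟨q, hq⟩ ⟨q', hq'⟩
    exact ⟨q.append q', by simpa using add_le_add hq hq'⟩
  · intro v a
    by_cases h : π a v = v
    · rw [if_pos h, h]
      exact ⟨.nil, by simp⟩
    · rw [if_neg h]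
      obtain ⟨q, hq⟩ := hwalk (.cons (hadj a v h) .nil)
      exact ⟨q, by rw [hq]; simp⟩
  -- Detour through the terminals of `u` and `v`: the lengths dominate the distance between these
  -- two, and the connecting paths are cheap and short.
  · rintro u v y ⟨huS, hu⟩ ⟨hvS, hv⟩ ⟨q, hq⟩
    have hq0 : 0 ≤ (q.edges.map ℓ).sum := List.sum_nonneg fun z hz => by
      obtain ⟨e, _, rfl⟩ := List.mem_map.1 hz
      exact hℓ e
    have hdu : (Γ.dist u (τ u) : ℝ) ≤ r := by
      exact_mod_cast (SimpleGraph.dist_le (p u)).trans (hpr u huS)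
    have hdv : (Γ.dist v (τ v) : ℝ) ≤ r := by
      exact_mod_cast (SimpleGraph.dist_le (p v)).trans (hpr v hvS)
    have htt : (Γ.dist (τ u) (τ v) : ℝ) ≤ y + 64 * (x * r) := by
      by_cases he : τ u = τ v
      · rw [he, SimpleGraph.dist_self]
        push_cast
        have : 0 < 64 * (x * r) := by positivity
        linarith
      · obtain ⟨qu, hqu⟩ := hwalk (p u)
        obtain ⟨qv, hqv⟩ := hwalk (p v)
        let q' := qu.reverse.append (q.append qv)
        have hq' : (q'.edges.map ℓ).sum = cost u + ((q.edges.map ℓ).sum + cost v) := by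
          simp [q', hqu, hqv, cost, List.sum_reverse]
        have h1 := hdist ⟨τ u, hτ u huS⟩ ⟨τ v, hτ v hvS⟩ (fun h => he (congrArg Subtype.val h))
          q'.bypass.edges.toFinset (CapGraph.mem_paths.2 ⟨q'.bypass, q'.bypass_isPath, rfl⟩)
        have h2 : ∑ e ∈ q'.bypass.edges.toFinset, ℓ e ≤ (q'.edges.map ℓ).sum := by
          rw [List.sum_toFinset _ q'.bypass_isPath.isTrail.edges_nodup]
          exact (q'.edges_bypass_sublist_edges.map ℓ).sum_le_sum fun z hz => by
            obtain ⟨e, _, rfl⟩ := List.mem_map.1 hz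
            exact hℓ e
        simp only at h1
        linarith
    have h3 := hc.dist_triangle (u := u) (v := τ u) (w := v)
    have h4 := hc.dist_triangle (u := τ u) (v := τ v) (w := v)
    rw [SimpleGraph.dist_comm (u := τ v)] at h4
    have h5 : (Γ.dist u v : ℝ) ≤ Γ.dist u (τ u) + (Γ.dist (τ u) (τ v) + Γ.dist v (τ v)) := by
      exact_mod_cast h3.trans (Nat.add_le_add_left h4 _)
    linarith
  · have hcol : ∑ v, ∑ a, (if π a v = v then 0 else pullLength F ℓ s(v, π a v)) ≤
        2 * ∑ e ∈ Γ.edgeFinset, pullLength F ℓ e := by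
      convert Γ.sum_colours_le π hadj hinj (pullLength F ℓ) hpull
    refine hcol.trans ?_
    have : 0 ≤ ((Δ / r : ℝ≥0) : ℝ) * ∑ u ∈ S, ∑ e ∈ (p u).edges.toFinset, pullLength F ℓ e :=
      mul_nonneg (NNReal.coe_nonneg _) hvol2
    linarith
  · rw [← hN, Fintype.card_fin, Nat.cast_sub (by omega)]
    push_cast
    have : 0 < 2 * r * (N * Δ) := by positivity
    linarith
  · rw [Fintype.card_coe]
    exact hF
  · have : 4 * r - 1 + 1 = 4 * r := by omega
    rw [this]
    linarith
  · rw [Fintype.card_fin]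
    omega
  · rw [Nat.cast_sub (by omega)]
    push_cast
    linarith
  · rw [Nat.cast_sub (by omega)]
    push_cast
    have : (64 * x + 4) * (4 * (r : ℝ)) ≤ R * (4 * r) := by gcongr
    have h0 : (0 : ℝ) ≤ 64 * (x * r) := by positivity
    linarith

open Classical in
/-- The quantitative form of the lower bound: a graph of almost constant degree `Δ` and girth about
`2 * h`, with `k` terminals that dominate almost all vertices at distance `2 * ρ`. -/
theorem exists_capGraph_of_parameters {n Δ h ρ k : ℕ} {x : ℝ} (hn : 0 < n) (hρ : 1 ≤ ρ)
    (hx : 1 ≤ x) (hρΔ : 512 * ρ ≤ Δ) (hxh : 384 * (x * ρ) + 20 * ρ ≤ h)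
    (hhn : 32 * (Δ * (Δ + 3) ^ (2 * h + 1 + ρ)) ≤ n) (hk : n ≤ (Δ - 1) ^ ρ * k) (hkn : k ≤ n) :
    ∃ (G : CapGraph (Fin n)) (T : Finset (Fin n)), G.graph.Connected ∧ T.card = k ∧
      ∀ (F : Finpartition (Finset.univ : Finset (Fin n))) (R : ℕ), 64 * x + 4 ≤ R →
        16 * (F.parts.card * (Δ + 3) ^ R) ≤ n →
        ∃ D : Demand T, ENNReal.ofReal x ≤ G.cong (fun t : T => (t : Fin n)) D ∧
          (G.contract F).cong (fun t : T => clusterOf F (t : Fin n)) D ≤ 3 := by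
  have : Nonempty (Fin n) := ⟨⟨0, hn⟩⟩
  obtain ⟨π, hπ, hfix⟩ := SimpleGraph.exists_isSparseMatching n Δ (2 * h + 1) hn (by omega)
  replace hfix : ∀ a, (Finset.univ.filter fun v => π a v = v).card ≤ (Δ + 3) ^ (2 * h + 1) :=
    fun a => by convert hfix a
  set Γ := SimpleGraph.pathSupMatchings π
  have hc : Γ.Connected := SimpleGraph.pathSupMatchings_connected hn π
  have hΓ : Γ.LocallyTree h := hπ.bypass.locallyTree hc
  have hadj : ∀ a v, π a v ≠ v → Γ.Adj v (π a v) := fun a v hv =>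
    (SimpleGraph.pathSupMatchings_adj hπ.invol).2 (Or.inr ⟨hv.symm, a, rfl⟩)
  have hdeg := SimpleGraph.card_adj_pathSupMatchings_le hπ.invol
  have hball : ∀ u ρ, (Finset.univ.filter fun v => Γ.dist u v ≤ ρ).card ≤ (Δ + 3) ^ ρ :=
    fun u ρ => by convert SimpleGraph.card_ball_le hc hdeg u ρ
  have hρh : ρ ≤ h := by
    have h1 : (1 : ℝ) ≤ ρ := by exact_mod_cast hρ
    have : (ρ : ℝ) ≤ h := by nlinarith
    exact_mod_cast this
  -- Around such vertices all degrees are at least `Δ`, so the ball of radius `ρ` has at least `(Δ -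
  -- 1) ^ ρ` elements.
  let S : Finset (Fin n) := Finset.univ.filter fun u => ∀ v, Γ.dist u v ≤ ρ → ∀ a, π a v ≠ v
  have hS : 16 * (Finset.univ.filter fun v => v ∉ S).card ≤ n := by
    have hsub : (Finset.univ.filter fun v => v ∉ S) ⊆
        Finset.univ.biUnion fun a => (Finset.univ.filter fun v => π a v = v).biUnion
          fun v => Finset.univ.filter fun u => Γ.dist v u ≤ ρ := by
      intro u hu
      simp only [S, Finset.mem_filter, Finset.mem_univ, true_and, not_forall, not_not] at hu
      obtain ⟨v, hv, a, ha⟩ := hu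
      simp only [Finset.mem_biUnion, Finset.mem_filter, Finset.mem_univ, true_and]
      exact ⟨a, v, ha, by rwa [SimpleGraph.dist_comm]⟩
    have h1 : (Finset.univ.filter fun v => v ∉ S).card ≤
        Δ * ((Δ + 3) ^ (2 * h + 1) * (Δ + 3) ^ ρ) := by
      refine (Finset.card_le_card hsub).trans (Finset.card_biUnion_le.trans ?_)
      calc _ ≤ ∑ _a : Fin Δ, (Δ + 3) ^ (2 * h + 1) * (Δ + 3) ^ ρ := by
            refine Finset.sum_le_sum fun a _ => Finset.card_biUnion_le.trans ?_
            refine (Finset.sum_le_sum fun v _ => hball v ρ).trans ?_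
            rw [Finset.sum_const, smul_eq_mul]
            gcongr
            exact hfix a
        _ = _ := by simp
    rw [← pow_add] at h1
    omega
  obtain ⟨T, hT, hdom⟩ := hc.exists_net S (ρ := ρ) (b := (Δ - 1) ^ ρ) (k := k)
    (pow_pos (by omega) ρ) (by
      intro u hu
      simp only [S, Finset.mem_filter, Finset.mem_univ, true_and] at hu
      refine (hΓ.pow_le_card_sphere hc u ρ hρh fun v hv => ?_).trans (Finset.card_le_card ?_)
      · have h1 : (Finset.univ.image fun a => π a v).card = Δ := by
          rw [Finset.card_image_of_injective]
          · simp
          · exact fun a a' haa' => hπ.inj a a' v haa' (hu v hv.le a)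
        have h2 : (Finset.univ.image fun a => π a v) ⊆ Finset.univ.filter (Γ.Adj v) := by
          intro w hw
          obtain ⟨a, _, rfl⟩ := Finset.mem_image.1 hw
          simpa using hadj a v (hu v hv.le a)
        have h3 := Finset.card_le_card h2
        omega
      · intro v hv
        simp only [Finset.mem_filter, Finset.mem_univ, true_and] at hv ⊢
        exact hv.le) (by simpa using hk) (by simpa using hkn)
  have hch : ∀ u, ∃ t, u ∈ S → t ∈ T ∧ Γ.dist u t ≤ 2 * ρ := by
    intro u
    by_cases hu : u ∈ S
    · obtain ⟨t, ht⟩ := hdom u hu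
      exact ⟨t, fun _ => ht⟩
    · exact ⟨u, fun h => absurd h hu⟩
  choose τ hτ using hch
  have hp : ∀ u, ∃ p : Γ.Walk u (τ u), p.IsPath ∧ p.length = Γ.dist u (τ u) :=
    fun u => hc.exists_path_of_dist u (τ u)
  choose p hp hplen using hp
  refine ⟨reinforcedGraph Γ S (fun u => (p u).edges.toFinset) (Δ / (2 * ρ : ℕ) : ℝ≥0), T, hc, hT,
    fun F R hR hF => ?_⟩
  have hkey := exists_demand_of_contract hc (r := 2 * ρ) (R := R) (B := (Δ + 3) ^ R)
    (Dn := (Δ + 3) ^ (2 * h + 1)) hΓ π hπ.invol hadj hπ.inj (fun v => by convert hdeg v)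
    (fun a => by convert hfix a) S T τ
    (fun u hu => (hτ u hu).1) p hp (fun u hu => (hplen u).trans_le (hτ u hu).2) hx (by omega)
    (by omega) (by push_cast; linarith) hR
    (fun u => (Finset.card_le_card fun v hv => by
      simp only [Finset.mem_filter, Finset.mem_univ, true_and] at hv ⊢
      exact hv.le).trans (hball u R)) (by convert hS; simp) ?_ F (by simpa using hF)
  · exact hkey
  · rw [Fintype.card_fin]
    refine le_trans ?_ hhn
    rw [pow_add _ (2 * h + 1) ρ]
    have h1 : 128 * (2 * ρ) ≤ 32 * Δ := by omega
    have h2 : 1 ≤ (Δ + 3) ^ ρ := Nat.one_le_pow _ _ (by omega)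
    calc 128 * (2 * ρ * (Δ + 3) ^ (2 * h + 1)) = 128 * (2 * ρ) * (Δ + 3) ^ (2 * h + 1) * 1 := by ring
      _ ≤ 32 * Δ * (Δ + 3) ^ (2 * h + 1) * (Δ + 3) ^ ρ := by gcongr
      _ = _ := by ring

/-! ### Choice of parameters -/

open Filter in
theorem eventually_logb_add_le (a : ℝ) {η δ : ℝ} (hη : 0 < η) (hδ : 0 < δ) :
    ∀ᶠ l : ℝ in atTop, Real.logb 2 l + a ≤ η * l ^ δ := by
  have h2 : 0 < Real.log 2 := Real.log_pos (by norm_num)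
  have h1 := (isLittleO_log_rpow_atTop hδ).def (c := η / 2 * Real.log 2) (by positivity)
  have h3 := ((tendsto_rpow_atTop hδ).const_mul_atTop (half_pos hη)).eventually_ge_atTop a
  filter_upwards [h1, h3, eventually_gt_atTop 0] with l hl1 hl2 hl0
  rw [Real.norm_of_nonneg (Real.rpow_nonneg hl0.le δ)] at hl1
  have h4 : Real.logb 2 l ≤ η / 2 * l ^ δ := by
    rw [Real.logb, div_le_iff₀ h2]
    calc _ ≤ _ := Real.le_norm_self _
      _ ≤ _ := hl1
      _ = _ := by ring
  linarith

theorem log_five_gt_two : 2 < Real.logb 2 5 := by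
  rw [Real.lt_logb_iff_rpow_lt (by norm_num) (by norm_num)]
  norm_num

open Filter in
theorem theorem3p1 (ε α β : ℝ) (hε0 : 0 < ε) (hε1 : ε < 1)
    (hα : α = Real.logb 2 5 / (Real.logb 2 5 + 1 - ε))
    (hβ : β = (Real.logb 2 5 - 0.5 * ε) / (Real.logb 2 5 + 1 - ε)) :
    ∃ c : ℝ, 0 < c ∧ ∃ (n₀ : ℕ) (N : ℝ → ℕ), ∀ n : ℕ, n₀ ≤ n →
      ∃ (G : CapGraph (Fin n)) (T : Finset (Fin n)),
        G.graph.Connected ∧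
        T.card = ⌊(n : ℝ) / (2 : ℝ) ^ ((Real.logb 2 n) ^ α)⌋₊ ∧
        ∀ C : ℝ, N C ≤ n →
          ∀ F : Finpartition (Finset.univ : Finset (Fin n)), ValidPartition T F →
            (F.parts.card : ℝ) ≤ C * ((n : ℝ) / (2 : ℝ) ^ ((Real.logb 2 n) ^ β)) →
              ∃ D : Demand T,
                ENNReal.ofReal (c * (Real.logb 2 n) ^ (1 - α)) ≤
                  G.cong (fun t : T => (t : Fin n)) D ∧
                (G.contract F).cong (fun t : T => clusterOf F (t : Fin n)) D ≤ 3 := by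
  have h5 := log_five_gt_two
  have hden : 0 < Real.logb 2 5 + 1 - ε := by linarith
  have hα0 : 0 < α := by rw [hα]; exact div_pos (by linarith) hden
  have hα1 : α < 1 := by rw [hα, div_lt_one hden]; linarith
  -- Of the exponents, only this inequality and `0 < α < 1` enter the argument.
  have hβα : 1 - α < β := by
    rw [hα, hβ, one_sub_div hden.ne', div_lt_div_iff_of_pos_right hden]
    linarith
  have hlim : Tendsto (fun n : ℕ => Real.logb 2 n) atTop atTop :=
    (Real.tendsto_logb_atTop (by norm_num)).comp tendsto_natCast_atTop_atTop
  have hev : ∀ᶠ n : ℕ in atTop, 10 ≤ Real.logb 2 n ∧ 10000 ≤ Real.logb 2 n ^ (1 - α) ∧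
      Real.logb 2 (Real.logb 2 n) + 11 ≤ 1 * Real.logb 2 n ^ α ∧
      2 * Real.logb 2 n ^ α ≤ Real.logb 2 n := by
    refine hlim.eventually (p := fun l => 10 ≤ l ∧ 10000 ≤ l ^ (1 - α) ∧
      Real.logb 2 l + 11 ≤ 1 * l ^ α ∧ 2 * l ^ α ≤ l) ?_
    filter_upwards [eventually_ge_atTop (10 : ℝ),
      (tendsto_rpow_atTop (sub_pos.2 hα1)).eventually_ge_atTop 10000,
      eventually_logb_add_le 11 one_pos hα0] with l h1 h2 h3
    refine ⟨h1, h2, h3, ?_⟩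
    have h4 : l = l ^ α * l ^ (1 - α) := by
      rw [← Real.rpow_add (by linarith), add_sub_cancel, Real.rpow_one]
    have h5 : 0 ≤ l ^ α := Real.rpow_nonneg (by linarith) _
    nlinarith
  obtain ⟨n₀, hn₀⟩ := eventually_atTop.1 hev
  have hevC : ∀ C : ℝ, ∃ N : ℕ, ∀ n : ℕ, N ≤ n →
      4 + Real.logb 2 (max C 1) +
        (Real.logb 2 (Real.logb 2 n) + 12) * (69 * (Real.logb 2 n ^ (1 - α) / 10000)) ≤
        Real.logb 2 n ^ β := by
    intro C
    refine eventually_atTop.1 (hlim.eventually (p := fun l => 4 + Real.logb 2 (max C 1) +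
      (Real.logb 2 l + 12) * (69 * (l ^ (1 - α) / 10000)) ≤ l ^ β) ?_)
    filter_upwards [eventually_ge_atTop (10 : ℝ),
      (tendsto_rpow_atTop (by linarith : 0 < β)).eventually_ge_atTop
        (2 * (4 + Real.logb 2 (max C 1))),
      eventually_logb_add_le 12 one_pos (sub_pos.2 hβα)] with l h1 h2 h3
    have h4 : l ^ β = l ^ (β - (1 - α)) * l ^ (1 - α) := by
      rw [← Real.rpow_add (by linarith), sub_add_cancel]
    have h5 : 0 ≤ l ^ (1 - α) := Real.rpow_nonneg (by linarith) _
    have h6 := mul_le_mul_of_nonneg_right h3 h5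
    rw [one_mul, ← h4] at h6
    have h7 : 0 ≤ l ^ β := Real.rpow_nonneg (by linarith) _
    linarith
  choose N hN using hevC
  refine ⟨1 / 10000, by norm_num, n₀, N, fun n hn => ?_⟩
  obtain ⟨hl10, hγ, hlog, hLl⟩ := hn₀ n hn
  have hNn := fun C => hN C n
  set l := Real.logb 2 n with hl
  set L := l ^ α with hL
  have hn0 : 0 < n := by
    rcases Nat.eq_zero_or_pos n with h | h
    · rw [h] at hl
      simp only [Nat.cast_zero, Real.logb_zero] at hl
      linarith
    · exact h
  have hnl : (2 : ℝ) ^ l = n :=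
    Real.rpow_logb (by norm_num) (by norm_num) (by exact_mod_cast hn0)
  obtain ⟨x, hx⟩ : ∃ x, x = 1 / 10000 * l ^ (1 - α) := ⟨_, rfl⟩
  have hx1 : 1 ≤ x := by rw [hx]; linarith
  have hxL : 10000 * (x * L) = l := by
    rw [hx, hL]
    calc _ = l ^ (1 - α) * l ^ α := by ring
      _ = l := by rw [← Real.rpow_add (by linarith), sub_add_cancel, Real.rpow_one]
  have hlog0 : 0 ≤ Real.logb 2 l := Real.logb_nonneg (by norm_num) (by linarith)
  -- The degree parameter will be `Δ = 2 ^ s + 1`, of order `log n`: large enough for `512 * ρ ≤ Δ`,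
  -- and with `Δ - 1` a power of two.
  obtain ⟨s, hs⟩ : ∃ s, s = ⌈Real.logb 2 l⌉₊ + 10 := ⟨_, rfl⟩
  have hs1 : (s : ℝ) ≤ Real.logb 2 l + 11 := by
    rw [hs]
    push_cast
    have := (Nat.ceil_lt_add_one hlog0).le
    linarith
  have hs10 : 10 ≤ s := by omega
  have hs10' : (10 : ℝ) ≤ s := by exact_mod_cast hs10
  have hsL : (s : ℝ) ≤ L := by linarith
  have hs2 : 1024 * l ≤ (2 : ℝ) ^ s := by
    rw [hs, pow_add]
    have h1 : l ≤ (2 : ℝ) ^ ⌈Real.logb 2 l⌉₊ := by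
      rw [← Real.rpow_natCast]
      calc l = (2 : ℝ) ^ Real.logb 2 l :=
            (Real.rpow_logb (by norm_num) (by norm_num) (by linarith)).symm
        _ ≤ _ := Real.rpow_le_rpow_of_exponent_le (by norm_num) (Nat.le_ceil _)
    linarith
  -- Least radius with `(Δ - 1) ^ ρ ≥ 4 * 2 ^ L`; the spare factor absorbs the floor in the number
  -- of terminals.
  obtain ⟨ρ, hρ⟩ : ∃ ρ, ρ = ⌈(L + 2) / s⌉₊ := ⟨_, rfl⟩
  have hρ1 : L + 2 ≤ s * ρ := by
    have := Nat.le_ceil ((L + 2) / s)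
    rw [← hρ, div_le_iff₀ (by linarith)] at this
    linarith
  have hρ2 : s * ρ ≤ L + 2 + s := by
    have := (Nat.ceil_lt_add_one (a := (L + 2) / s) (by positivity)).le
    rw [← hρ, ← sub_le_iff_le_add, le_div_iff₀ (by linarith)] at this
    linarith
  have hρpos : 1 ≤ ρ := by
    rw [hρ, Nat.one_le_ceil_iff]
    positivity
  have hρ' : (1 : ℝ) ≤ ρ := by exact_mod_cast hρpos
  obtain ⟨h, hh⟩ : ∃ h, h = ⌈384 * (x * ρ) + 20 * ρ⌉₊ := ⟨_, rfl⟩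
  have hh1 : 384 * (x * ρ) + 20 * ρ ≤ h := by rw [hh]; exact Nat.le_ceil _
  have hh2 : (h : ℝ) ≤ 384 * (x * ρ) + 20 * ρ + 1 := by
    rw [hh]; exact (Nat.ceil_lt_add_one (by positivity)).le
  have hΔ3 : 2 ^ s + 1 + 3 ≤ 2 ^ (s + 1) := by
    have : 2 ^ 10 ≤ 2 ^ s := Nat.pow_le_pow_right (by norm_num) hs10
    rw [pow_succ]
    omega
  have hpow : (2 : ℝ) ^ L ≤ n / 2 := by
    rw [le_div_iff₀ (by norm_num), ← hnl]
    calc (2 : ℝ) ^ L * 2 = 2 ^ (L + 1) := by rw [Real.rpow_add_one (by norm_num)]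
      _ ≤ 2 ^ l := Real.rpow_le_rpow_of_exponent_le (by norm_num) (by linarith)
  have h2L : (0 : ℝ) < 2 ^ L := Real.rpow_pos_of_pos (by norm_num) _
  have hn2L : 2 ≤ (n : ℝ) / 2 ^ L := by
    rw [le_div_iff₀ h2L]
    linarith
  obtain ⟨G, T, hG, hT, hmain⟩ := exists_capGraph_of_parameters (n := n) (Δ := 2 ^ s + 1) (h := h)
    (ρ := ρ) (k := ⌊(n : ℝ) / (2 : ℝ) ^ L⌋₊) (x := x) hn0 hρpos hx1 (by
      have h1 : (ρ : ℝ) ≤ l := by nlinarith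
      have h2 : (512 : ℝ) * ρ ≤ 2 ^ s := by linarith
      have h3 : 512 * ρ ≤ 2 ^ s := by exact_mod_cast h2
      omega) hh1 (by
      have h1 : 32 * ((2 ^ s + 1) * (2 ^ s + 1 + 3) ^ (2 * h + 1 + ρ)) ≤
          2 ^ (5 + (s + 1) * (2 * h + 2 + ρ)) := by
        calc _ ≤ 32 * (2 ^ (s + 1) * (2 ^ (s + 1)) ^ (2 * h + 1 + ρ)) := by gcongr; omega
          _ = _ := by rw [← pow_mul]; ring
      refine h1.trans ?_
      have h2 : ((2 ^ (5 + (s + 1) * (2 * h + 2 + ρ)) : ℕ) : ℝ) ≤ n := by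
        rw [← hnl]
        push_cast
        rw [← Real.rpow_natCast]
        refine Real.rpow_le_rpow_of_exponent_le (by norm_num) ?_
        push_cast
        have hxρ : 1 ≤ x * ρ := one_le_mul_of_one_le_of_one_le hx1 hρ'
        have hxρ' : (ρ : ℝ) ≤ x * ρ := le_mul_of_one_le_left (by linarith) hx1
        -- With `s + 1 ≤ 2 * s` and `s * ρ ≤ 3 * L`, the exponent is at most `5 + 4878 * (x * L)`,
        -- below `l = 10000 * (x * L)`.
        have e1 : 2 * (h : ℝ) + 2 + ρ ≤ 813 * (x * ρ) := by linarith
        have e2 : ((s : ℝ) + 1) * (2 * h + 2 + ρ) ≤ (2 * s) * (813 * (x * ρ)) :=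
          mul_le_mul (by linarith) e1 (by positivity) (by positivity)
        have e3 : x * (s * ρ) ≤ x * (3 * L) :=
          mul_le_mul_of_nonneg_left (by linarith) (by linarith)
        linarith
      exact_mod_cast h2) (by
      have h1 : (n : ℝ) / 2 ^ L / 2 ≤ ⌊(n : ℝ) / (2 : ℝ) ^ L⌋₊ := by
        have := Nat.lt_floor_add_one ((n : ℝ) / (2 : ℝ) ^ L)
        linarith
      have h2 : (2 : ℝ) ^ L * 4 ≤ (2 ^ s) ^ ρ := by
        calc (2 : ℝ) ^ L * 4 = 2 ^ (L + 2) := by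
              rw [Real.rpow_add (by norm_num)]; norm_num
          _ ≤ (2 : ℝ) ^ ((s : ℝ) * ρ) := Real.rpow_le_rpow_of_exponent_le (by norm_num) hρ1
          _ = (2 ^ s) ^ ρ := by
              rw [← pow_mul, ← Real.rpow_natCast]
              push_cast
              rfl
      have h3 : (n : ℝ) ≤ (2 ^ s) ^ ρ * ⌊(n : ℝ) / (2 : ℝ) ^ L⌋₊ := by
        calc (n : ℝ) ≤ (2 : ℝ) ^ L * 4 * (n / 2 ^ L / 2) := by
              field_simp
              norm_num
          _ ≤ _ := by gcongr
      have h4 : 2 ^ s + 1 - 1 = 2 ^ s := by omega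
      rw [h4]
      exact_mod_cast h3) (by
      have h1 : ⌊(n : ℝ) / (2 : ℝ) ^ L⌋₊ ≤ (n : ℝ) / 2 ^ L := Nat.floor_le (by positivity)
      have h2 : (n : ℝ) / 2 ^ L ≤ n :=
        div_le_self (Nat.cast_nonneg _) (Real.one_le_rpow (by norm_num) (by linarith))
      exact_mod_cast h1.trans h2)
  refine ⟨G, T, hG, hT, fun C hC F _ hF => ?_⟩
  rw [← hx]
  refine hmain F ⌈64 * x + 4⌉₊ (Nat.le_ceil _) ?_
  have hR : (⌈64 * x + 4⌉₊ : ℝ) ≤ 69 * x := by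
    have := (Nat.ceil_lt_add_one (a := 64 * x + 4) (by linarith)).le
    linarith
  have hlast := hNn C hC
  have hp1 : ((2 ^ s + 1 + 3 : ℕ) : ℝ) ^ ⌈64 * x + 4⌉₊ ≤
      (2 : ℝ) ^ ((Real.logb 2 l + 12) * (69 * (l ^ (1 - α) / 10000))) := by
    calc ((2 ^ s + 1 + 3 : ℕ) : ℝ) ^ ⌈64 * x + 4⌉₊ ≤ ((2 : ℝ) ^ (s + 1)) ^ ⌈64 * x + 4⌉₊ := by
          gcongr
          exact_mod_cast hΔ3
      _ = (2 : ℝ) ^ (((s : ℝ) + 1) * ⌈64 * x + 4⌉₊) := by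
          rw [← pow_mul, ← Real.rpow_natCast]
          push_cast
          rfl
      _ ≤ _ := by
          refine Real.rpow_le_rpow_of_exponent_le (by norm_num) ?_
          have e1 : 69 * (l ^ (1 - α) / 10000) = 69 * x := by rw [hx]; ring
          rw [e1]
          exact mul_le_mul (by linarith) hR (Nat.cast_nonneg _) (by linarith)
  have hC1 : 0 < max C 1 := lt_max_of_lt_right one_pos
  -- The only place where `C` and `β` enter: the constant and the ball size together are absorbed by
  -- `2 ^ (l ^ β)`.
  have hprod : 16 * (max C 1 *
      (2 : ℝ) ^ ((Real.logb 2 l + 12) * (69 * (l ^ (1 - α) / 10000)))) ≤ 2 ^ (l ^ β) := by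
    calc _ = (2 : ℝ) ^ (4 + Real.logb 2 (max C 1) +
          (Real.logb 2 l + 12) * (69 * (l ^ (1 - α) / 10000))) := by
          rw [Real.rpow_add (by norm_num), Real.rpow_add (by norm_num),
            Real.rpow_logb (by norm_num) (by norm_num) hC1]
          norm_num
          ring
      _ ≤ _ := Real.rpow_le_rpow_of_exponent_le (by norm_num) hlast
  have h2β : (0 : ℝ) < 2 ^ (l ^ β) := Real.rpow_pos_of_pos (by norm_num) _
  have hfin : 16 * ((F.parts.card : ℝ) * ((2 ^ s + 1 + 3 : ℕ) : ℝ) ^ ⌈64 * x + 4⌉₊) ≤ n := by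
    calc _ ≤ 16 * ((max C 1 * ((n : ℝ) / 2 ^ (l ^ β))) *
          (2 : ℝ) ^ ((Real.logb 2 l + 12) * (69 * (l ^ (1 - α) / 10000)))) := by
          gcongr
          refine hF.trans ?_
          gcongr
          exact le_max_left _ _
      _ = 16 * (max C 1 * (2 : ℝ) ^ ((Real.logb 2 l + 12) * (69 * (l ^ (1 - α) / 10000)))) *
          (n / 2 ^ (l ^ β)) := by ring
      _ ≤ 2 ^ (l ^ β) * (n / 2 ^ (l ^ β)) := by gcongr
      _ = n := by field_simp
  exact_mod_cast hfin
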